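/- Work in the language $\{0,1,+,\cdot,<,\in\}$ of second-order arithmetic. Let $\mathsf{RCA}_0$ be the theory consisting of the basic axioms on $0,1,+,\cdot,<$, induction for $\Sigma^0_1$ formulae and comprehension for $\Delta^0_1$ formulae (both with parameters). In this language, rational numbers are coded by natural numbers; a real number is a sequence $(q_i)$ of rationals with $|q_i-q_j|\le 2^{-i}$ for $i\le j$; a partial continuous function $f:[0,1]\to\mathbb R$ is a set of pairs $(U,V)$, with $U=(p,q)\cap[0,1]\neq\varnothing$ and $V=(r,s)\neq\varnothing$ rational open intervals, such that (i) $(U,V),(U,V')\in f$ implies $V\cap V'\ne\varnothing$, (ii) $(U,V)\in f$ and $U'\subseteq U$ imply $(U',V)\in f$, (iii) $(U,V)\in f$ and $V\subseteq V'$ imply $(U,V')\in f$. It is total if for every real $x\in[0,1]$ and every rational $\varepsilon>0$ there is $(U,V)\in f$ such that $x\in U$ and $V$ has length at most $\varepsilon$; then $f(x)$ is the real, unique up to equality of reals, that lies in $\overline V$ whenever $(U,V)\in f$ and $x\in U$. It is a gauge if $f(x)>0$ for all reals $x\in[0,1]$. A tagged partition is a finite sequence of reals $0=x_0<t_0<x_1<\dots<t_{\ell-1}<x_\ell=1$;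 it is $f$-fine if $t_j-f(t_j)\le x_j$ and $t_j+f(t_j)\ge x_{j+1}$ for all $j<\ell$. Let $\mathsf{CL}_{\mathrm c}$ be the sentence "every total continuous gauge $f$ on $[0,1]$ has an $f$-fine tagged partition". Let $\mathrm{REC}$ be the $\omega$-model whose sets are exactly the computable subsets of $\mathbb N$. A real number is computable if it is the limit of a computable sequence of rationals $(q_i)$ with $|q_i-q_j|\le 2^{-i}$ for $i\le j$. **Theorem.** $\mathsf{RCA}_0$ does not prove $\mathsf{CL}_{\mathrm c}$. In fact $\mathrm{REC}$ is a model of $\mathsf{RCA}_0$ in which $\mathsf{CL}_{\mathrm c}$ is false, and a counterexample can be obtained as follows. There is a computable sequence $\psi(n)=(p_n,q_n)$ of pairs of rationals such that the $\Pi^0_1$ class $$K=[0,1]\setminus\bigcup_{n}(p_n,q_n)$$ is nonempty and contains no computable real, and such that, with the spikes $\mathrm{sp}_n(x)=\max\{0,\min\{\tfrac12,\,x-p_n,\,q_n-x\}\}$, the function $$\delta(x)=\sum_{n=0}^\infty 2^{-n-2}\,\mathrm{sp}_n(x)$$ has the following properties. 1. $|\delta(x)-\delta(y)|\le|x-y|$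 for all real $x,y$. 2. For $x\in[0,1]$, $\delta(x)>0$ if and only if $x\notin K$; in particular $\delta(x)>0$ at every computable $x\in[0,1]$. 3. There is no tagged partition $0=x_0<t_0<x_1<\dots<t_{\ell-1}<x_\ell=1$ consisting of computable reals with $t_j-\delta(t_j)\le x_j$ and $x_{j+1}\le t_j+\delta(t_j)$ for all $j<\ell$. 4. There is a computable set $f$ of pairs $(U,V)$ of rational intervals which codes $\delta$ on $[0,1]$: $\delta(U)\subseteq V$ for all $(U,V)\in f$, and for every real $x\in[0,1]$ and rational $\varepsilon>0$ there is $(U,V)\in f$ with $x\in U$ and $V$ of length at most $\varepsilon$. Moreover $\mathrm{REC}$ satisfies "$f$ is a total continuous gauge" and does not satisfy "there is an $f$-fine tagged partition". -/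

import Mathlib

namespace SOA

/-! ### The language of second-order arithmetic

Terms and formulae are well-scoped, with de Bruijn indices: `Formula n m` has its free number
variables in `Fin n` and its free set variables in `Fin m`; a quantifier binds the index `0`. -/

/-- Numerical terms with free variables among `n` number variables. -/
inductive Term (n : ℕ) : Type
  | var : Fin n → Term n
  | zero : Term n
  | one : Term n
  | add : Term n → Term n → Term n
  | mul : Term n → Term n → Term n

/-- Set terms: there are only the set variables. -/
structure SetVar (m : ℕ) : Type where
  idx : Fin m

/-- Formulae of the language `{0, 1, +, ·, <, ∈}` (with equality of numbers). -/
inductive Formula : ℕ → ℕ → Type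
  | eq {n m : ℕ} : Term n → Term n → Formula n m
  | lt {n m : ℕ} : Term n → Term n → Formula n m
  | mem {n m : ℕ} : Term n → SetVar m → Formula n m
  | neg {n m : ℕ} : Formula n m → Formula n m
  | and {n m : ℕ} : Formula n m → Formula n m → Formula n m
  | or {n m : ℕ} : Formula n m → Formula n m → Formula n m
  | imp {n m : ℕ} : Formula n m → Formula n m → Formula n m
  | iff {n m : ℕ} : Formula n m → Formula n m → Formula n m
  | all {n m : ℕ} : Formula (n + 1) m → Formula n m
  | ex {n m : ℕ} : Formula (n + 1) m → Formula n m
  | allSet {n m : ℕ} : Formula n (m + 1) → Formula n m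
  | exSet {n m : ℕ} : Formula n (m + 1) → Formula n m

/-- Sentences are formulae without free variables. -/
abbrev Sentence : Type := Formula 0 0

/-- Simultaneous substitution of terms for the number variables of a term. -/
def Term.subst {n k : ℕ} (σ : Fin n → Term k) : Term n → Term k
  | .var i => σ i
  | .zero => .zero
  | .one => .one
  | .add s t => .add (s.subst σ) (t.subst σ)
  | .mul s t => .mul (s.subst σ) (t.subst σ)

/-- Weakening of a term by a new number variable with index `0`. -/
def Term.lift {n : ℕ} (t : Term n) : Term (n + 1) := t.subst fun i => .var i.succ

/-- Weakening of a set variable by a new set variable with index `0`. -/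
def SetVar.lift {m : ℕ} (X : SetVar m) : SetVar (m + 1) := ⟨X.idx.succ⟩

instance {n : ℕ} : Coe (Term n) (Term (n + 1)) := ⟨Term.lift⟩
instance {m : ℕ} : Coe (SetVar m) (SetVar (m + 1)) := ⟨SetVar.lift⟩

/-- Simultaneous capture-avoiding substitution of terms for number variables and of set variables
for set variables. -/
def Formula.subst : {n m k l : ℕ} → (Fin n → Term k) → (Fin m → SetVar l) →
    Formula n m → Formula k l
  | _, _, _, _, σ, _, .eq s t => .eq (s.subst σ) (t.subst σ)
  | _, _, _, _, σ, _, .lt s t => .lt (s.subst σ) (t.subst σ)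
  | _, _, _, _, σ, τ, .mem t X => .mem (t.subst σ) (τ X.idx)
  | _, _, _, _, σ, τ, .neg φ => .neg (φ.subst σ τ)
  | _, _, _, _, σ, τ, .and φ ψ => .and (φ.subst σ τ) (ψ.subst σ τ)
  | _, _, _, _, σ, τ, .or φ ψ => .or (φ.subst σ τ) (ψ.subst σ τ)
  | _, _, _, _, σ, τ, .imp φ ψ => .imp (φ.subst σ τ) (ψ.subst σ τ)
  | _, _, _, _, σ, τ, .iff φ ψ => .iff (φ.subst σ τ) (ψ.subst σ τ)
  | _, _, _, _, σ, τ, .all φ => .all (φ.subst (Fin.cons (.var 0) fun i => (σ i).lift) τ)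
  | _, _, _, _, σ, τ, .ex φ => .ex (φ.subst (Fin.cons (.var 0) fun i => (σ i).lift) τ)
  | _, _, _, _, σ, τ, .allSet φ => .allSet (φ.subst σ (Fin.cons ⟨0⟩ fun i => (τ i).lift))
  | _, _, _, _, σ, τ, .exSet φ => .exSet (φ.subst σ (Fin.cons ⟨0⟩ fun i => (τ i).lift))

/-- Weakening of a formula by a new number variable. -/
def Formula.liftN {n m : ℕ} (φ : Formula n m) : Formula (n + 1) m :=
  φ.subst (fun i => .var i.succ) fun X => ⟨X⟩

/-- Weakening of a formula by a new set variable. -/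
def Formula.liftS {n m : ℕ} (φ : Formula n m) : Formula n (m + 1) :=
  φ.subst .var fun X => ⟨X.succ⟩

/-- `φ[t]`: the term `t` is substituted for the number variable with index `0`. -/
def Formula.inst {n m : ℕ} (φ : Formula (n + 1) m) (t : Term n) : Formula n m :=
  φ.subst (Fin.cons t .var) fun X => ⟨X⟩

/-- `φ[Y]`: the set variable `Y` is substituted for the set variable with index `0`. -/
def Formula.instSet {n m : ℕ} (φ : Formula n (m + 1)) (Y : SetVar m) : Formula n m :=
  φ.subst .var (Fin.cons Y fun X => ⟨X⟩)

/-- A sentence, regarded as a formula with any free variables. -/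
def Formula.ofSentence {n m : ℕ} (φ : Sentence) : Formula n m :=
  φ.subst (fun i => i.elim0) fun X => X.elim0

/-- Universal quantification over all free set variables. -/
def Formula.closeSets {n : ℕ} : {m : ℕ} → Formula n m → Formula n 0
  | 0, φ => φ
  | _ + 1, φ => Formula.closeSets (.allSet φ)

/-- Universal quantification over all free number variables. -/
def Formula.closeNumbers {m : ℕ} : {n : ℕ} → Formula n m → Formula 0 m
  | 0, φ => φ
  | _ + 1, φ => Formula.closeNumbers (.all φ)

/-- The universal closure of a formula. -/
def Formula.closure {n m : ℕ} (φ : Formula n m) : Sentence := φ.closeSets.closeNumbers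

/-! ### Provability -/

/-- Natural deduction for classical two-sorted first-order logic with equality of numbers:
`Derives T Γ φ` says that `φ` is derivable from the sentences in `T` and the assumptions `Γ`. -/
inductive Derives (T : Set Sentence) : {n m : ℕ} → List (Formula n m) → Formula n m → Prop
  | ax {n m : ℕ} {Γ : List (Formula n m)} {φ : Sentence} :
      φ ∈ T → Derives T Γ (Formula.ofSentence φ)
  | assumption {n m : ℕ} {Γ : List (Formula n m)} {φ : Formula n m} : φ ∈ Γ → Derives T Γ φ
  | negI {n m : ℕ} {Γ : List (Formula n m)} {φ ψ : Formula n m} :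
      Derives T (φ :: Γ) ψ → Derives T (φ :: Γ) (.neg ψ) → Derives T Γ (.neg φ)
  | byContra {n m : ℕ} {Γ : List (Formula n m)} {φ ψ : Formula n m} :
      Derives T (.neg φ :: Γ) ψ → Derives T (.neg φ :: Γ) (.neg ψ) → Derives T Γ φ
  | andI {n m : ℕ} {Γ : List (Formula n m)} {φ ψ : Formula n m} :
      Derives T Γ φ → Derives T Γ ψ → Derives T Γ (.and φ ψ)
  | andE₁ {n m : ℕ} {Γ : List (Formula n m)} {φ ψ : Formula n m} :
      Derives T Γ (.and φ ψ) → Derives T Γ φ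
  | andE₂ {n m : ℕ} {Γ : List (Formula n m)} {φ ψ : Formula n m} :
      Derives T Γ (.and φ ψ) → Derives T Γ ψ
  | orI₁ {n m : ℕ} {Γ : List (Formula n m)} {φ ψ : Formula n m} :
      Derives T Γ φ → Derives T Γ (.or φ ψ)
  | orI₂ {n m : ℕ} {Γ : List (Formula n m)} {φ ψ : Formula n m} :
      Derives T Γ ψ → Derives T Γ (.or φ ψ)
  | orE {n m : ℕ} {Γ : List (Formula n m)} {φ ψ χ : Formula n m} :
      Derives T Γ (.or φ ψ) → Derives T (φ :: Γ) χ → Derives T (ψ :: Γ) χ → Derives T Γ χ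
  | impI {n m : ℕ} {Γ : List (Formula n m)} {φ ψ : Formula n m} :
      Derives T (φ :: Γ) ψ → Derives T Γ (.imp φ ψ)
  | impE {n m : ℕ} {Γ : List (Formula n m)} {φ ψ : Formula n m} :
      Derives T Γ (.imp φ ψ) → Derives T Γ φ → Derives T Γ ψ
  | iffI {n m : ℕ} {Γ : List (Formula n m)} {φ ψ : Formula n m} :
      Derives T (φ :: Γ) ψ → Derives T (ψ :: Γ) φ → Derives T Γ (.iff φ ψ)
  | iffE₁ {n m : ℕ} {Γ : List (Formula n m)} {φ ψ : Formula n m} :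
      Derives T Γ (.iff φ ψ) → Derives T Γ φ → Derives T Γ ψ
  | iffE₂ {n m : ℕ} {Γ : List (Formula n m)} {φ ψ : Formula n m} :
      Derives T Γ (.iff φ ψ) → Derives T Γ ψ → Derives T Γ φ
  | allI {n m : ℕ} {Γ : List (Formula n m)} {φ : Formula (n + 1) m} :
      Derives T (Γ.map Formula.liftN) φ → Derives T Γ (.all φ)
  | allE {n m : ℕ} {Γ : List (Formula n m)} {φ : Formula (n + 1) m} (t : Term n) :
      Derives T Γ (.all φ) → Derives T Γ (φ.inst t)
  | exI {n m : ℕ} {Γ : List (Formula n m)} {φ : Formula (n + 1) m} (t : Term n) :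
      Derives T Γ (φ.inst t) → Derives T Γ (.ex φ)
  | exE {n m : ℕ} {Γ : List (Formula n m)} {φ : Formula (n + 1) m} {ψ : Formula n m} :
      Derives T Γ (.ex φ) → Derives T (φ :: Γ.map Formula.liftN) ψ.liftN → Derives T Γ ψ
  | allSetI {n m : ℕ} {Γ : List (Formula n m)} {φ : Formula n (m + 1)} :
      Derives T (Γ.map Formula.liftS) φ → Derives T Γ (.allSet φ)
  | allSetE {n m : ℕ} {Γ : List (Formula n m)} {φ : Formula n (m + 1)} (Y : SetVar m) :
      Derives T Γ (.allSet φ) → Derives T Γ (φ.instSet Y)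
  | exSetI {n m : ℕ} {Γ : List (Formula n m)} {φ : Formula n (m + 1)} (Y : SetVar m) :
      Derives T Γ (φ.instSet Y) → Derives T Γ (.exSet φ)
  | exSetE {n m : ℕ} {Γ : List (Formula n m)} {φ : Formula n (m + 1)} {ψ : Formula n m} :
      Derives T Γ (.exSet φ) → Derives T (φ :: Γ.map Formula.liftS) ψ.liftS → Derives T Γ ψ
  | eqRefl {n m : ℕ} {Γ : List (Formula n m)} (t : Term n) : Derives T Γ (.eq t t)
  | eqSubst {n m : ℕ} {Γ : List (Formula n m)} {φ : Formula (n + 1) m} (s t : Term n) :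
      Derives T Γ (.eq s t) → Derives T Γ (φ.inst s) → Derives T Γ (φ.inst t)

/-- The theory `T` proves the sentence `φ`. -/
def Proves (T : Set Sentence) (φ : Sentence) : Prop := Derives T [] φ

/-! ### `ω`-models -/

/-- The value of a numerical term in `ℕ`. -/
def Term.eval {n : ℕ} (v : Fin n → ℕ) : Term n → ℕ
  | .var i => v i
  | .zero => 0
  | .one => 1
  | .add s t => s.eval v + t.eval v
  | .mul s t => s.eval v * t.eval v

/-- Truth of a formula in the `ω`-model `M ⊆ 𝒫(ℕ)`, under an assignment of its free variables. -/
def Formula.Holds (M : Set (Set ℕ)) : {n m : ℕ} → Formula n m →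
    (Fin n → ℕ) → (Fin m → Set ℕ) → Prop
  | _, _, .eq s t, v, _ => s.eval v = t.eval v
  | _, _, .lt s t, v, _ => s.eval v < t.eval v
  | _, _, .mem t X, v, w => t.eval v ∈ w X.idx
  | _, _, .neg φ, v, w => ¬ φ.Holds M v w
  | _, _, .and φ ψ, v, w => φ.Holds M v w ∧ ψ.Holds M v w
  | _, _, .or φ ψ, v, w => φ.Holds M v w ∨ ψ.Holds M v w
  | _, _, .imp φ ψ, v, w => φ.Holds M v w → ψ.Holds M v w
  | _, _, .iff φ ψ, v, w => φ.Holds M v w ↔ ψ.Holds M v w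
  | _, _, .all φ, v, w => ∀ a : ℕ, φ.Holds M (Fin.cons a v) w
  | _, _, .ex φ, v, w => ∃ a : ℕ, φ.Holds M (Fin.cons a v) w
  | _, _, .allSet φ, v, w => ∀ A ∈ M, φ.Holds M v (Fin.cons A w)
  | _, _, .exSet φ, v, w => ∃ A ∈ M, φ.Holds M v (Fin.cons A w)

/-- Truth of a sentence in an `ω`-model. -/
def Models (M : Set (Set ℕ)) (φ : Sentence) : Prop := φ.Holds M ![] ![]

/-- The `ω`-model of the computable sets. -/
def REC : Set (Set ℕ) := {A | ComputablePred fun k => k ∈ A}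

/-! ### Connectives and binders used to write formulae

`allN fun x => φ` and the like give a name to the variable that the quantifier binds. -/

def allN {n m : ℕ} (F : Term (n + 1) → Formula (n + 1) m) : Formula n m := .all (F (.var 0))

def exN {n m : ℕ} (F : Term (n + 1) → Formula (n + 1) m) : Formula n m := .ex (F (.var 0))

def allS {n m : ℕ} (F : SetVar (m + 1) → Formula n (m + 1)) : Formula n m := .allSet (F ⟨0⟩)

def exS {n m : ℕ} (F : SetVar (m + 1) → Formula n (m + 1)) : Formula n m := .exSet (F ⟨0⟩)

def le {n m : ℕ} (s t : Term n) : Formula n m := .or (.lt s t) (.eq s t)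

local infixl:65 " ∔ " => Term.add
local infixl:70 " ⊡ " => Term.mul
local infix:50 " ≐ " => Formula.eq
local infix:50 " ≺ " => Formula.lt
local infix:50 " ≼ " => le
local infix:50 " ε " => Formula.mem
local infixr:35 " ⊓' " => Formula.and
local infixr:30 " ⊔' " => Formula.or
local infixr:25 " ⇒ " => Formula.imp
local infix:20 " ⇔ " => Formula.iff

/-! ### The system `RCA₀` -/

/-- Formulae all of whose quantifiers are bounded number quantifiers `∀ x < t`, `∃ x < t`. -/
inductive IsBounded : {n m : ℕ} → Formula n m → Prop
  | eq {n m : ℕ} (s t : Term n) : IsBounded (.eq s t : Formula n m)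
  | lt {n m : ℕ} (s t : Term n) : IsBounded (.lt s t : Formula n m)
  | mem {n m : ℕ} (t : Term n) (X : SetVar m) : IsBounded (.mem t X)
  | neg {n m : ℕ} {φ : Formula n m} : IsBounded φ → IsBounded (.neg φ)
  | and {n m : ℕ} {φ ψ : Formula n m} : IsBounded φ → IsBounded ψ → IsBounded (.and φ ψ)
  | or {n m : ℕ} {φ ψ : Formula n m} : IsBounded φ → IsBounded ψ → IsBounded (.or φ ψ)
  | imp {n m : ℕ} {φ ψ : Formula n m} : IsBounded φ → IsBounded ψ → IsBounded (.imp φ ψ)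
  | iff {n m : ℕ} {φ ψ : Formula n m} : IsBounded φ → IsBounded ψ → IsBounded (.iff φ ψ)
  | ball {n m : ℕ} (t : Term n) {φ : Formula (n + 1) m} :
      IsBounded φ → IsBounded (.all (.imp (.lt (.var 0) t.lift) φ))
  | bex {n m : ℕ} (t : Term n) {φ : Formula (n + 1) m} :
      IsBounded φ → IsBounded (.ex (.and (.lt (.var 0) t.lift) φ))

/-- `Σ⁰₁` formulae: existential number quantifiers in front of a bounded formula. -/
inductive IsSigma01 : {n m : ℕ} → Formula n m → Prop
  | of {n m : ℕ} {φ : Formula n m} : IsBounded φ → IsSigma01 φ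
  | ex {n m : ℕ} {φ : Formula (n + 1) m} : IsSigma01 φ → IsSigma01 (.ex φ)

/-- `Π⁰₁` formulae: universal number quantifiers in front of a bounded formula. -/
inductive IsPi01 : {n m : ℕ} → Formula n m → Prop
  | of {n m : ℕ} {φ : Formula n m} : IsBounded φ → IsPi01 φ
  | all {n m : ℕ} {φ : Formula (n + 1) m} : IsPi01 φ → IsPi01 (.all φ)

/-- The basic axioms on `0, 1, +, ·, <`. -/
def basicAxioms : Set Sentence :=
  {(allN fun x => .neg (x ∔ .one ≐ .zero) : Sentence),
   (allN fun x => allN fun y => (x : Term 2) ∔ .one ≐ y ∔ .one ⇒ (x : Term 2) ≐ y : Sentence),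
   (allN fun x => x ∔ .zero ≐ x : Sentence),
   (allN fun x => allN fun y => (x : Term 2) ∔ (y ∔ .one) ≐ (x : Term 2) ∔ y ∔ .one : Sentence),
   (allN fun x => x ⊡ .zero ≐ .zero : Sentence),
   (allN fun x => allN fun y => (x : Term 2) ⊡ (y ∔ .one) ≐ (x : Term 2) ⊡ y ∔ x : Sentence),
   (allN fun x => .neg (x ≺ .zero) : Sentence),
   (allN fun x => allN fun y =>
     (x : Term 2) ≺ y ∔ .one ⇔ ((x : Term 2) ≺ y ⊔' (x : Term 2) ≐ y) : Sentence)}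

/-- The induction axiom `φ(0) ∧ ∀x (φ(x) → φ(x + 1)) → ∀x φ(x)`, where `x` has index `0` and all
other free variables are parameters. -/
def inductionAxiom {n m : ℕ} (φ : Formula (n + 1) m) : Formula n m :=
  φ.inst .zero ⊓'
    .all (φ ⇒ φ.subst (Fin.cons (.var 0 ∔ .one) fun i => .var i.succ) fun X => ⟨X⟩) ⇒ .all φ

/-- The comprehension axiom `∀x (φ(x) ↔ ψ(x)) → ∃X ∀x (x ∈ X ↔ φ(x))`, where `x` has index `0` and
all other free variables are parameters. -/
def deltaComprehension {n m : ℕ} (φ ψ : Formula (n + 1) m) : Formula n m :=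
  .all (φ ⇔ ψ) ⇒ exS fun X => .all (.var 0 ε X ⇔ φ.liftS)

/-- `RCA₀`: the basic axioms, `Σ⁰₁` induction and `Δ⁰₁` comprehension. -/
def RCA0 : Set Sentence :=
  basicAxioms ∪
  {θ | ∃ (n m : ℕ) (φ : Formula (n + 1) m), IsSigma01 φ ∧ θ = (inductionAxiom φ).closure} ∪
  {θ | ∃ (n m : ℕ) (φ ψ : Formula (n + 1) m), IsSigma01 φ ∧ IsPi01 ψ ∧
    θ = (deltaComprehension φ ψ).closure}

/-! ### Number systems in second-order arithmetic -/

/-- The pair `(s, t)`, coded by the number `(s + t)² + s`. -/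
def pair {n : ℕ} (s t : Term n) : Term n := (s ∔ t) ⊡ (s ∔ t) ∔ s

/-- `(a, b)` is an integer (standing for `a - b`): it is the least among the pairs `(p, q)` with
`a + q = b + p`. -/
def isInt {n m : ℕ} (a b : Term n) : Formula n m :=
  allN fun p => allN fun q => (a : Term (n + 2)) ∔ q ≐ (b : Term (n + 2)) ∔ p ⇒
    pair (a : Term (n + 2)) b ≼ pair (p : Term (n + 2)) q

/-- A representation `(pos - neg) / den` of a rational number by three numerical terms. -/
structure RatTerm (n : ℕ) : Type where
  pos : Term n
  neg : Term n
  den : Term n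

def RatTerm.lift {n : ℕ} (ρ : RatTerm n) : RatTerm (n + 1) := ⟨ρ.pos, ρ.neg, ρ.den⟩

instance {n : ℕ} : Coe (RatTerm n) (RatTerm (n + 1)) := ⟨RatTerm.lift⟩

namespace RatTerm

variable {n m : ℕ}

def zero : RatTerm n := ⟨.zero, .zero, .one⟩

def one : RatTerm n := ⟨.one, .zero, .one⟩

/-- `1 / d` -/
def inv (d : Term n) : RatTerm n := ⟨.one, .zero, d⟩

def add (ρ σ : RatTerm n) : RatTerm n :=
  ⟨ρ.pos ⊡ σ.den ∔ σ.pos ⊡ ρ.den, ρ.neg ⊡ σ.den ∔ σ.neg ⊡ ρ.den, ρ.den ⊡ σ.den⟩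

def sub (ρ σ : RatTerm n) : RatTerm n := ρ.add ⟨σ.neg, σ.pos, σ.den⟩

/-- Equality of rational numbers, by cross multiplication. -/
def eq (ρ σ : RatTerm n) : Formula n m :=
  ρ.pos ⊡ σ.den ∔ σ.neg ⊡ ρ.den ≐ σ.pos ⊡ ρ.den ∔ ρ.neg ⊡ σ.den

def lt (ρ σ : RatTerm n) : Formula n m :=
  ρ.pos ⊡ σ.den ∔ σ.neg ⊡ ρ.den ≺ σ.pos ⊡ ρ.den ∔ ρ.neg ⊡ σ.den

def le (ρ σ : RatTerm n) : Formula n m :=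
  ρ.pos ⊡ σ.den ∔ σ.neg ⊡ ρ.den ≼ σ.pos ⊡ ρ.den ∔ ρ.neg ⊡ σ.den

/-- The number coding the pair of the integers `(pos, neg)` and `(den, 0)`. -/
def code (ρ : RatTerm n) : Term n := pair (pair ρ.pos ρ.neg) (pair ρ.den .zero)

/-- `ρ.code` is a rational number: a pair of an integer and a positive integer, which is the least
in its class of equal fractions. (A positive integer is always of the form `(d, 0)`.) -/
def isRat (ρ : RatTerm n) : Formula n m :=
  isInt ρ.pos ρ.neg ⊓' .zero ≺ ρ.den ⊓'
    allN fun a => allN fun b => allN fun d =>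
      isInt (a : Term (n + 3)) b ⊓' .zero ≺ d ⊓' (ρ : RatTerm (n + 3)).eq ⟨a, b, d⟩ ⇒
        (ρ : RatTerm (n + 3)).code ≼ code ⟨a, b, d⟩

end RatTerm

/-- For all rational numbers `ρ`. -/
def allQ {n m : ℕ} (F : RatTerm (n + 3) → Formula (n + 3) m) : Formula n m :=
  allN fun a => allN fun b => allN fun d =>
    (⟨a, b, d⟩ : RatTerm (n + 3)).isRat ⇒ F ⟨a, b, d⟩

/-- There is a rational number `ρ`. -/
def exQ {n m : ℕ} (F : RatTerm (n + 3) → Formula (n + 3) m) : Formula n m :=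
  exN fun a => exN fun b => exN fun d =>
    (⟨a, b, d⟩ : RatTerm (n + 3)).isRat ⊓' F ⟨a, b, d⟩

/-- `y` is the remainder of `c` modulo `(i + 1) * b + 1`, the value at `i` of the finite sequence
coded by `c, b` through Gödel's `β`-function. -/
def betaEq {n m : ℕ} (c b i y : Term n) : Formula n m :=
  y ≺ (i ∔ .one) ⊡ b ∔ .one ⊓'
    exN fun z => (c : Term (n + 1)) ≐ z ⊡ ((i ∔ .one) ⊡ b ∔ .one : Term n) ∔ y

/-- `e = 2 ^ k`: there is a finite sequence starting with `1`, doubling `k` times, and arriving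
at `e`. -/
def isPow2 {n m : ℕ} (k e : Term n) : Formula n m :=
  exN fun c => exN fun b =>
    betaEq (c : Term (n + 2)) b .zero .one ⊓'
    betaEq (c : Term (n + 2)) b k e ⊓'
    allN fun i => allN fun y => (i : Term (n + 4)) ≺ k ⊓' betaEq (c : Term (n + 4)) b i y ⇒
      betaEq (c : Term (n + 4)) b (i ∔ .one : Term (n + 3)) (y ∔ y)

/-- `X` is a sequence of rational numbers, i.e. a function from `ℕ` to `ℚ`, coded as a set of
pairs. -/
def isSeqRat {n m : ℕ} (X : SetVar m) : Formula n m :=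
  (allN fun z => z ε X ⇒ exN fun k => exQ fun ρ =>
    (z : Term (n + 5)) ≐ pair (k : Term (n + 5)) ρ.code)
  ⊓' allN fun k => exN fun c => pair (k : Term (n + 2)) c ε X ⊓'
      allN fun c' => pair (k : Term (n + 3)) c' ε X ⇒ c' ≐ c

/-- For the `k`-th term `ρ` of the sequence of rational numbers `X`. -/
def allVal {n m : ℕ} (X : SetVar m) (k : Term n) (F : RatTerm (n + 3) → Formula (n + 3) m) :
    Formula n m :=
  allQ fun ρ => pair (k : Term (n + 3)) ρ.code ε X ⇒ F ρ

/-- `X` is a real number: a sequence of rational numbers with `|X i - X j| ≤ 2 ^ (-i)` for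
`i ≤ j`. -/
def isReal {n m : ℕ} (X : SetVar m) : Formula n m :=
  isSeqRat X ⊓'
  allN fun i => allN fun j => allN fun e =>
    (i : Term (n + 3)) ≼ j ⊓' isPow2 (i : Term (n + 3)) e ⇒
    allVal X (i : Term (n + 3)) fun ρ => allVal X (j : Term (n + 6)) fun σ =>
      (ρ : RatTerm (n + 9)).le (σ.add (.inv e)) ⊓' σ.le ((ρ : RatTerm (n + 9)).add (.inv e))

/-- `2 · 2 ^ (-k)`, where `e = 2 ^ k`. -/
def twoInv {n : ℕ} (e : Term n) : RatTerm n := (RatTerm.inv e).add (.inv e)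

/-- `X ≤ Y` for real numbers: `X k ≤ Y k + 2 ^ (-k + 1)` for all `k`. -/
def realLe {n m : ℕ} (X Y : SetVar m) : Formula n m :=
  allN fun k => allN fun e => isPow2 (k : Term (n + 2)) e ⇒
    allVal X (k : Term (n + 2)) fun ρ => allVal Y (k : Term (n + 5)) fun σ =>
      (ρ : RatTerm (n + 8)).le (σ.add (twoInv e))

def realLt {n m : ℕ} (X Y : SetVar m) : Formula n m := .neg (realLe Y X)

/-- `X ≤ ρ` for a real number `X` and a rational number `ρ`, identified with the constant
sequence. -/
def realLeRat {n m : ℕ} (X : SetVar m) (ρ : RatTerm n) : Formula n m :=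
  allN fun k => allN fun e => isPow2 (k : Term (n + 2)) e ⇒
    allVal X (k : Term (n + 2)) fun σ => σ.le ((ρ : RatTerm (n + 5)).add (twoInv e))

/-- `ρ ≤ X` for a rational number `ρ` and a real number `X`. -/
def ratLeReal {n m : ℕ} (ρ : RatTerm n) (X : SetVar m) : Formula n m :=
  allN fun k => allN fun e => isPow2 (k : Term (n + 2)) e ⇒
    allVal X (k : Term (n + 2)) fun σ => (ρ : RatTerm (n + 5)).le (σ.add (twoInv e))

def realLtRat {n m : ℕ} (X : SetVar m) (ρ : RatTerm n) : Formula n m := .neg (ratLeReal ρ X)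

def ratLtReal {n m : ℕ} (ρ : RatTerm n) (X : SetVar m) : Formula n m := .neg (realLeRat X ρ)

/-- `X` is a real number in `[0, 1]`. -/
def inUnit {n m : ℕ} (X : SetVar m) : Formula n m :=
  isReal X ⊓' ratLeReal .zero X ⊓' realLeRat X .one

/-- `T - Y ≤ X` for real numbers; the `k`-th term of `T - Y` is `T (k + 1) - Y (k + 1)`. -/
def subLe {n m : ℕ} (T Y X : SetVar m) : Formula n m :=
  allN fun k => allN fun e => isPow2 (k : Term (n + 2)) e ⇒
    allVal T (k ∔ .one : Term (n + 1)) fun τ => allVal Y (k ∔ .one : Term (n + 1)) fun υ =>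
      allVal X (k : Term (n + 8)) fun ξ =>
        ((τ : RatTerm (n + 11)).sub υ).le (ξ.add (twoInv e))

/-- `X ≤ T + Y` for real numbers; the `k`-th term of `T + Y` is `T (k + 1) + Y (k + 1)`. -/
def leAdd {n m : ℕ} (X T Y : SetVar m) : Formula n m :=
  allN fun k => allN fun e => isPow2 (k : Term (n + 2)) e ⇒
    allVal T (k ∔ .one : Term (n + 1)) fun τ => allVal Y (k ∔ .one : Term (n + 1)) fun υ =>
      allVal X (k : Term (n + 8)) fun ξ =>
        ξ.le (((τ : RatTerm (n + 11)).add υ).add (twoInv e))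

/-! ### Continuous functions `[0, 1] → ℝ` in second-order arithmetic -/

/-- `(p, q)` codes a basic open interval `U = (p, q) ∩ [0, 1]` of `[0, 1]`:
`max p 0 < min q 1`. -/
def isBasicUnit {n m : ℕ} (p q : RatTerm n) : Formula n m :=
  p.lt q ⊓' p.lt .one ⊓' RatTerm.zero.lt q

/-- `(p', q') ∩ [0, 1] ⊆ (p, q) ∩ [0, 1]`. -/
def unitSubset {n m : ℕ} (p' q' p q : RatTerm n) : Formula n m :=
  (p.lt .zero ⊔' p.le p') ⊓' (RatTerm.one.lt q ⊔' q'.le q)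

/-- The real number `X` lies in `(p, q) ∩ [0, 1]`. -/
def inInterval {n m : ℕ} (X : SetVar m) (p q : RatTerm n) : Formula n m :=
  inUnit X ⊓' ratLtReal p X ⊓' realLtRat X q

/-- The number coding the pair `(U, V)` of the intervals `U = (p, q) ∩ [0, 1]` and
`V = (r, s)`. -/
def boxCode {n : ℕ} (p q r s : RatTerm n) : Term n :=
  pair (pair p.code q.code) (pair r.code s.code)

/-- The quadruples `p, q, r, s` of rational numbers with the pair `(p, q), (r, s)` in `f`. -/
def allBox {n m : ℕ} (f : SetVar m)
    (F : RatTerm (n + 12) → RatTerm (n + 12) → RatTerm (n + 12) → RatTerm (n + 12) →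
      Formula (n + 12) m) : Formula n m :=
  allQ fun p => allQ fun q => allQ fun r => allQ fun s =>
    boxCode (p : RatTerm (n + 12)) q r s ε f ⇒ F p q r s

def exBox {n m : ℕ} (f : SetVar m)
    (F : RatTerm (n + 12) → RatTerm (n + 12) → RatTerm (n + 12) → RatTerm (n + 12) →
      Formula (n + 12) m) : Formula n m :=
  exQ fun p => exQ fun q => exQ fun r => exQ fun s =>
    boxCode (p : RatTerm (n + 12)) q r s ε f ⊓' F p q r s

/-- `f` is (a code of) a partial continuous function `[0, 1] → ℝ`: a set of pairs `(U, V)` of basic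
open intervals such that
* if `(U, V)` and `(U, V')` are in `f` then `V` and `V'` intersect;
* if `(U, V)` is in `f` and `U' ⊆ U` then `(U', V)` is in `f`;
* if `(U, V)` is in `f` and `V ⊆ V'` then `(U, V')` is in `f`. -/
def isContFun {n m : ℕ} (f : SetVar m) : Formula n m :=
  (allN fun z => z ε f ⇒ exQ fun p => exQ fun q => exQ fun r => exQ fun s =>
    (z : Term (n + 13)) ≐ boxCode (p : RatTerm (n + 13)) q r s ⊓'
      isBasicUnit (p : RatTerm (n + 13)) q ⊓' (r : RatTerm (n + 13)).lt s)
  ⊓' (allBox f fun p q r s => allQ fun r' => allQ fun s' =>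
    boxCode (p : RatTerm (n + 18)) q r' s' ε f ⇒
      (r : RatTerm (n + 18)).lt s' ⊓' (r' : RatTerm (n + 18)).lt s)
  ⊓' (allBox f fun p q r s => allQ fun p' => allQ fun q' =>
    isBasicUnit (p' : RatTerm (n + 18)) q' ⊓' unitSubset (p' : RatTerm (n + 18)) q' p q ⇒
      boxCode (p' : RatTerm (n + 18)) q' r s ε f)
  ⊓' (allBox f fun p q r s => allQ fun r' => allQ fun s' =>
    (r' : RatTerm (n + 18)).le r ⊓' (s : RatTerm (n + 18)).le s' ⇒
      boxCode (p : RatTerm (n + 18)) q r' s' ε f)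

/-- The real number `X` is in the domain of `f`: for every positive rational `η` there is a pair
`(U, V)` in `f` such that `X` is in `U` and `V` has length at most `η`. -/
def inDomain {n m : ℕ} (f X : SetVar m) : Formula n m :=
  allQ fun η => RatTerm.zero.lt η ⇒
    exBox f fun p q r s => inInterval X p q ⊓' (s.sub r).le η

/-- `f` is total. -/
def isTotal {n m : ℕ} (f : SetVar m) : Formula n m :=
  allS fun X => inUnit X ⇒ inDomain f X

/-- The real number `Y` is the value of `f` at `X`: `X` is in the domain of `f`, and `Y` is in the
closure of `V` whenever `(U, V)` is in `f` and `X` is in `U`. -/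
def isValue {n m : ℕ} (f X Y : SetVar m) : Formula n m :=
  inDomain f X ⊓' isReal Y ⊓'
    allBox f fun p q r s => inInterval X p q ⇒ ratLeReal r Y ⊓' realLeRat Y s

/-- `f` is a gauge: `f(X) > 0` for all real numbers `X` in `[0, 1]`. -/
def isGauge {n m : ℕ} (f : SetVar m) : Formula n m :=
  allS fun X => inUnit X ⇒ exS fun Y => isValue (f : SetVar (m + 2)) X Y ⊓' ratLtReal .zero Y

/-! ### Partitions and Cousin's lemma in second-order arithmetic -/

/-- `X` is the real number in place `i` of the sequence of real numbers `P`, which is coded as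
the set of the pairs `(i, z)` with `z` in the `i`-th real number. -/
def isEntry {n m : ℕ} (P : SetVar m) (i : Term n) (X : SetVar m) : Formula n m :=
  isReal X ⊓' allN fun z => z ε X ⇔ pair (i : Term (n + 1)) z ε P

/-- `P` is a tagged partition `x₀, t₀, x₁, …, t_{ℓ-1}, x_ℓ` of `[0, 1]`: a finite sequence of
`2ℓ + 1` real numbers, where `x_j` has place `2j` and `t_j` has place `2j + 1`, such that
`x₀ = 0`, `x_ℓ = 1`, and `x_j < t_j < x_{j+1}` for all `j < ℓ`. -/
def isPartition {n m : ℕ} (P : SetVar m) (ℓ : Term n) : Formula n m :=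
  (allN fun z => z ε P ⇒ exN fun i => exN fun y =>
    (i : Term (n + 3)) ≼ (ℓ ∔ ℓ : Term n) ⊓' (z : Term (n + 3)) ≐ pair (i : Term (n + 3)) y)
  ⊓' (allN fun i => i ≼ (ℓ ∔ ℓ : Term n) ⇒ exS fun X => isEntry P i X)
  ⊓' (exS fun X => isEntry P .zero X ⊓' ratLeReal .zero X ⊓' realLeRat X .zero)
  ⊓' (exS fun X => isEntry P (ℓ ∔ ℓ) X ⊓' ratLeReal .one X ⊓' realLeRat X .one)
  ⊓' (allN fun j => j ≺ ℓ ⇒ exS fun X => exS fun T => exS fun X' =>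
    isEntry (P : SetVar (m + 3)) (j ∔ j) X ⊓'
    isEntry (P : SetVar (m + 3)) (j ∔ j ∔ .one) T ⊓'
    isEntry (P : SetVar (m + 3)) (j ∔ j ∔ .one ∔ .one) X' ⊓'
    realLt (X : SetVar (m + 3)) T ⊓' realLt (T : SetVar (m + 3)) X')

/-- The partition `P` of size `ℓ` is `f`-fine: `t_j - f(t_j) ≤ x_j` and `t_j + f(t_j) ≥ x_{j+1}`
for all `j < ℓ`. -/
def isFine {n m : ℕ} (f P : SetVar m) (ℓ : Term n) : Formula n m :=
  allN fun j => j ≺ ℓ ⇒ exS fun X => exS fun T => exS fun X' => exS fun Y =>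
    isEntry (P : SetVar (m + 4)) (j ∔ j) X ⊓'
    isEntry (P : SetVar (m + 4)) (j ∔ j ∔ .one) T ⊓'
    isEntry (P : SetVar (m + 4)) (j ∔ j ∔ .one ∔ .one) X' ⊓'
    isValue (f : SetVar (m + 4)) T Y ⊓'
    subLe (T : SetVar (m + 4)) Y X ⊓' leAdd (X' : SetVar (m + 4)) T Y

/-- There is an `f`-fine tagged partition of `[0, 1]`. -/
def hasFinePartition {n m : ℕ} (f : SetVar m) : Formula n m :=
  exS fun P => exN fun ℓ => isPartition P ℓ ⊓' isFine (f : SetVar (m + 1)) P ℓ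

/-- `f` is a total continuous gauge. -/
def isTotalContGauge {n m : ℕ} (f : SetVar m) : Formula n m :=
  isContFun f ⊓' isTotal f ⊓' isGauge f

/-- Cousin's lemma for continuous functions, as a sentence of second-order arithmetic. -/
def CLc : Sentence := allS fun f => isTotalContGauge f ⇒ hasFinePartition f

/-! ### Computable reals, `Π⁰₁` classes and the sum of spikes -/

/-- The number `(a + b)² + a`. -/
def natPair (a b : ℕ) : ℕ := (a + b) * (a + b) + a

/-- The code of a rational number: numerator `z` as the integer `(z⁺, z⁻)`, denominator `d` as the
integer `(d, 0)`. -/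
def ratCode (q : ℚ) : ℕ := natPair (natPair q.num.toNat (-q.num).toNat) (natPair q.den 0)

/-- `x` is the limit of a computable sequence of rationals with `|q i - q j| ≤ 2 ^ (-i)` for
`i ≤ j`. -/
def IsComputableReal (x : ℝ) : Prop :=
  ∃ q : ℕ → ℚ, Computable (fun k => ratCode (q k)) ∧
    (∀ i j, i ≤ j → |q i - q j| ≤ (1 / 2) ^ i) ∧
    Filter.Tendsto (fun k => (q k : ℝ)) Filter.atTop (nhds x)

/-- `[0, 1]` minus the union of the intervals `U_{ψ(k)} = (p, q) ∩ [0, 1]`, `(p, q) = ψ k`. -/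
def piClass (ψ : ℕ → ℚ × ℚ) : Set ℝ :=
  Set.Icc 0 1 \ ⋃ k, Set.Ioo ((ψ k).1 : ℝ) ((ψ k).2 : ℝ)

/-- The spike with slopes `±1` on `(p, q)`, cut off at height `1 / 2`. -/
noncomputable def spike (p q : ℚ) (x : ℝ) : ℝ := max 0 (min (1 / 2) (min (x - p) (q - x)))

/-- `∑ₖ 2 ^ (-k - 2) * spₖ(x)`, where `spₖ` is the spike on the interval `ψ k`. -/
noncomputable def spikeSum (ψ : ℕ → ℚ × ℚ) (x : ℝ) : ℝ :=
  ∑' k, (1 / 2) ^ (k + 2) * spike (ψ k).1 (ψ k).2 x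

/-- The set of pairs `f` codes the continuous function `δ` on `[0, 1]`: `δ(U) ⊆ V` for all
pairs `(U, V)` in `f`, and every real number in `[0, 1]` lies in some `U` with `(U, V)` in `f` and
`V` as short as desired. -/
def CodesFunction (f : Set ℕ) (δ : ℝ → ℝ) : Prop :=
  (∀ p q r s : ℚ, natPair (natPair (ratCode p) (ratCode q)) (natPair (ratCode r) (ratCode s)) ∈ f →
    ∀ x ∈ Set.Icc (0 : ℝ) 1, (p : ℝ) < x → x < q → (r : ℝ) < δ x ∧ δ x < s) ∧
  ∀ x ∈ Set.Icc (0 : ℝ) 1, ∀ η : ℚ, 0 < η → ∃ p q r s : ℚ,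
    natPair (natPair (ratCode p) (ratCode q)) (natPair (ratCode r) (ratCode s)) ∈ f ∧
    (p : ℝ) < x ∧ x < q ∧ s - r ≤ η

/-- There is a `δ`-fine tagged partition of `[0, 1]` whose points and tags are computable reals. -/
def HasComputableFinePartition (δ : ℝ → ℝ) : Prop :=
  ∃ (ℓ : ℕ) (x t : ℕ → ℝ), x 0 = 0 ∧ x ℓ = 1 ∧
    (∀ j ≤ ℓ, IsComputableReal (x j)) ∧ (∀ j < ℓ, IsComputableReal (t j)) ∧
    (∀ j < ℓ, x j < t j ∧ t j < x (j + 1)) ∧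
    ∀ j < ℓ, t j - δ (t j) ≤ x j ∧ x (j + 1) ≤ t j + δ (t j)

end SOA

/-!
The cover is built by letting the `e`-th program predict a real: if it outputs a code of a rational
at input `e + 4`, an interval of radius `2 ^ (-(e + 3))` about that rational is enumerated. A
program that computes a real puts this real into its own interval, while the total length of the
intervals is at most `1 / 2`, so `K` is nonempty and contains no computable real.

The weights of the spikes add up to `1 / 2`, so `δ` is `1 / 2`-Lipschitz, and it vanishes on `K`.
For `y ∈ K` this gives `δ t ≤ |t - y| / 2`. Hence an interval `[t - δ t, t + δ t]` with `0 < δ t`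
never contains `y`, and the intervals of a fine partition, which cover `[0, 1]`, cannot all have
tags outside `K`. The reals of `REC` are the computable ones, so `REC` sees in `δ` a total gauge
without a fine partition, and `RCA₀` does not prove `CLc` by soundness.
-/

namespace SOA

/-! ### Soundness -/

@[simp]
theorem Term.eval_subst {n k : ℕ} (σ : Fin n → Term k) (v : Fin k → ℕ) (t : Term n) :
    (t.subst σ).eval v = t.eval fun i => (σ i).eval v := by
  induction t with
  | var i => rfl
  | zero => rfl
  | one => rfl
  | add s t hs ht => simp [Term.subst, Term.eval, hs, ht]
  | mul s t hs ht => simp [Term.subst, Term.eval, hs, ht]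

@[simp]
theorem Term.eval_lift {n : ℕ} (t : Term n) (a : ℕ) (v : Fin n → ℕ) :
    t.lift.eval (Fin.cons a v : Fin (n + 1) → ℕ) = t.eval v := by
  simp [Term.lift, Term.eval]

theorem Term.eval_cons_lift {n k : ℕ} (σ : Fin n → Term k) (a : ℕ) (v : Fin k → ℕ) :
    (fun i => ((Fin.cons (.var 0) fun i => (σ i).lift : Fin (n + 1) → Term (k + 1)) i).eval
      (Fin.cons a v : Fin (k + 1) → ℕ)) = (Fin.cons a fun i => (σ i).eval v : Fin (n + 1) → ℕ) := by
  funext i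
  cases i using Fin.cases <;> simp [Term.eval]

theorem SetVar.idx_cons_lift {m l : ℕ} (τ : Fin m → SetVar l) (A : Set ℕ) (w : Fin l → Set ℕ) :
    (fun j => (Fin.cons A w : Fin (l + 1) → Set ℕ)
      ((Fin.cons ⟨0⟩ fun i => (τ i).lift : Fin (m + 1) → SetVar (l + 1)) j).idx) =
      (Fin.cons A fun j => w (τ j).idx : Fin (m + 1) → Set ℕ) := by
  funext j
  cases j using Fin.cases <;> simp [SetVar.lift]

theorem Formula.holds_subst (M : Set (Set ℕ)) {n m : ℕ} (φ : Formula n m) :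
    ∀ {k l : ℕ} (σ : Fin n → Term k) (τ : Fin m → SetVar l) (v : Fin k → ℕ) (w : Fin l → Set ℕ),
      (φ.subst σ τ).Holds M v w ↔
        φ.Holds M (fun i => (σ i).eval v) fun j => w (τ j).idx := by
  induction φ with
  | all φ ih | ex φ ih =>
    intro k l σ τ v w
    simp only [Formula.subst, Formula.Holds, ih, Term.eval_cons_lift]
  | allSet φ ih | exSet φ ih =>
    intro k l σ τ v w
    simp only [Formula.subst, Formula.Holds, ih, SetVar.idx_cons_lift]
  | _ => simp_all [Formula.subst, Formula.Holds]

section Holds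

variable (M : Set (Set ℕ)) {n m : ℕ} (v : Fin n → ℕ) (w : Fin m → Set ℕ)

@[simp]
theorem Formula.holds_liftN (φ : Formula n m) (a : ℕ) :
    φ.liftN.Holds M (Fin.cons a v) w ↔ φ.Holds M v w := by
  simp [Formula.liftN, Formula.holds_subst, Term.eval]

@[simp]
theorem Formula.holds_liftS (φ : Formula n m) (A : Set ℕ) :
    φ.liftS.Holds M v (Fin.cons A w) ↔ φ.Holds M v w := by
  simp [Formula.liftS, Formula.holds_subst, Term.eval]

@[simp]
theorem Formula.holds_inst (φ : Formula (n + 1) m) (t : Term n) :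
    (φ.inst t).Holds M v w ↔ φ.Holds M (Fin.cons (t.eval v) v) w := by
  rw [Formula.inst, Formula.holds_subst]
  congr! 1
  funext i
  cases i using Fin.cases <;> simp [Term.eval]

@[simp]
theorem Formula.holds_instSet (φ : Formula n (m + 1)) (Y : SetVar m) :
    (φ.instSet Y).Holds M v w ↔ φ.Holds M v (Fin.cons (w Y.idx) w) := by
  rw [Formula.instSet, Formula.holds_subst]
  congr! 1
  funext j
  cases j using Fin.cases <;> simp

@[simp]
theorem Formula.holds_ofSentence (φ : Sentence) :
    (Formula.ofSentence φ : Formula n m).Holds M v w ↔ Models M φ := by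
  rw [Formula.ofSentence, Formula.holds_subst, Models]
  congr!

end Holds

theorem Derives.sound {T : Set Sentence} {M : Set (Set ℕ)} (hT : ∀ φ ∈ T, Models M φ) {n m : ℕ}
    {Γ : List (Formula n m)} {φ : Formula n m} (h : Derives T Γ φ) :
    ∀ (v : Fin n → ℕ) (w : Fin m → Set ℕ), (∀ i, w i ∈ M) → (∀ χ ∈ Γ, χ.Holds M v w) →
      φ.Holds M v w := by
  induction h with (intro v w hw hΓ; try simp only [List.forall_mem_cons, and_imp] at *)
  | ax h => simpa using hT _ h
  | assumption h => exact hΓ _ h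
  | negI _ _ ih₁ ih₂ => exact fun hφ => ih₂ v w hw hφ hΓ (ih₁ v w hw hφ hΓ)
  | byContra _ _ ih₁ ih₂ => exact by_contra fun hφ => ih₂ v w hw hφ hΓ (ih₁ v w hw hφ hΓ)
  | andI _ _ ih₁ ih₂ => exact ⟨ih₁ v w hw hΓ, ih₂ v w hw hΓ⟩
  | andE₁ _ ih => exact (ih v w hw hΓ).1
  | andE₂ _ ih => exact (ih v w hw hΓ).2
  | orI₁ _ ih => exact .inl (ih v w hw hΓ)
  | orI₂ _ ih => exact .inr (ih v w hw hΓ)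
  | orE _ _ _ ih ih₁ ih₂ =>
    exact (ih v w hw hΓ).elim (fun h => ih₁ v w hw h hΓ) fun h => ih₂ v w hw h hΓ
  | impI _ ih => exact fun hφ => ih v w hw hφ hΓ
  | impE _ _ ih₁ ih₂ => exact ih₁ v w hw hΓ (ih₂ v w hw hΓ)
  | iffI _ _ ih₁ ih₂ => exact ⟨fun h => ih₁ v w hw h hΓ, fun h => ih₂ v w hw h hΓ⟩
  | iffE₁ _ _ ih₁ ih₂ => exact (ih₁ v w hw hΓ).1 (ih₂ v w hw hΓ)
  | iffE₂ _ _ ih₁ ih₂ => exact (ih₁ v w hw hΓ).2 (ih₂ v w hw hΓ)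
  | allI _ ih => exact fun a => ih _ w hw (by simpa using hΓ)
  | allE t _ ih => simpa using ih v w hw hΓ (t.eval v)
  | exI t _ ih => exact ⟨t.eval v, by simpa using ih v w hw hΓ⟩
  | exE _ _ ih₁ ih₂ =>
    obtain ⟨a, ha⟩ := ih₁ v w hw hΓ
    simpa using ih₂ (Fin.cons a v) w hw ha (by simpa using hΓ)
  | allSetI _ ih => exact fun A hA => ih v _ (Fin.cases hA hw) (by simpa using hΓ)
  | allSetE Y _ ih => simpa using ih v w hw hΓ _ (hw Y.idx)
  | exSetI Y _ ih => exact ⟨_, hw Y.idx, by simpa using ih v w hw hΓ⟩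
  | exSetE _ _ ih₁ ih₂ =>
    obtain ⟨A, hA, h⟩ := ih₁ v w hw hΓ
    simpa using ih₂ v (Fin.cons A w) (Fin.cases hA hw) h (by simpa using hΓ)
  | eqRefl t => rfl
  | eqSubst s t _ _ ih₁ ih₂ =>
    have heq : s.eval v = t.eval v := ih₁ v w hw hΓ
    simpa [heq] using ih₂ v w hw hΓ

theorem Proves.models {T : Set Sentence} {M : Set (Set ℕ)} (hT : ∀ φ ∈ T, Models M φ)
    {φ : Sentence} (h : Proves T φ) : Models M φ :=
  Derives.sound hT h _ _ (fun i => i.elim0) (by simp)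

theorem Formula.holds_closeNumbers {M : Set (Set ℕ)} {n m : ℕ} {φ : Formula n m}
    {w : Fin m → Set ℕ} (h : ∀ v, φ.Holds M v w) : φ.closeNumbers.Holds M ![] w := by
  induction n with
  | zero => exact h _
  | succ n ih => exact ih (φ := .all φ) fun v a => h _

theorem Formula.holds_closeSets {M : Set (Set ℕ)} {n m : ℕ} {φ : Formula n m} {v : Fin n → ℕ}
    (h : ∀ w : Fin m → Set ℕ, (∀ i, w i ∈ M) → φ.Holds M v w) : φ.closeSets.Holds M v ![] := by
  induction m with
  | zero => exact h _ fun i => i.elim0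
  | succ m ih => exact ih (φ := .allSet φ) fun w hw A hA => h _ (Fin.cases hA hw)

theorem Models.closure {M : Set (Set ℕ)} {n m : ℕ} {φ : Formula n m}
    (h : ∀ v (w : Fin m → Set ℕ), (∀ i, w i ∈ M) → φ.Holds M v w) : Models M φ.closure :=
  Formula.holds_closeNumbers fun v => Formula.holds_closeSets (h v)

/-! ### The computable sets form a model of `RCA₀` -/

section Computability

variable {α β : Type*} [Primcodable α] [Primcodable β]

theorem computable_nat_add {f g : α → ℕ} (hf : Computable f) (hg : Computable g) :
    Computable fun a => f a + g a :=
  Primrec.nat_add.to_comp.comp hf hg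

theorem computable_nat_mul {f g : α → ℕ} (hf : Computable f) (hg : Computable g) :
    Computable fun a => f a * g a :=
  Primrec.nat_mul.to_comp.comp hf hg

theorem computablePred_comp {p : β → Prop} (hp : ComputablePred p) {f : α → β}
    (hf : Computable f) : ComputablePred fun a => p (f a) := by
  obtain ⟨g, hg, rfl⟩ := ComputablePred.computable_iff.1 hp
  exact ComputablePred.computable_iff.2 ⟨_, hg.comp hf, rfl⟩

theorem computablePred_and {p q : α → Prop} (hp : ComputablePred p) (hq : ComputablePred q) :
    ComputablePred fun a => p a ∧ q a := by
  obtain ⟨f, hf, rfl⟩ := ComputablePred.computable_iff.1 hp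
  obtain ⟨g, hg, rfl⟩ := ComputablePred.computable_iff.1 hq
  exact ComputablePred.computable_iff.2 ⟨_, Primrec.and.to_comp.comp hf hg, by simp⟩

theorem computablePred_or {p q : α → Prop} (hp : ComputablePred p) (hq : ComputablePred q) :
    ComputablePred fun a => p a ∨ q a :=
  (computablePred_and hp.not hq.not).not.of_eq fun a => by tauto

theorem computablePred_imp {p q : α → Prop} (hp : ComputablePred p) (hq : ComputablePred q) :
    ComputablePred fun a => p a → q a :=
  (computablePred_or hp.not hq).of_eq fun a => by tauto

theorem computablePred_iff {p q : α → Prop} (hp : ComputablePred p) (hq : ComputablePred q) :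
    ComputablePred fun a => p a ↔ q a :=
  (computablePred_and (computablePred_imp hp hq) (computablePred_imp hq hp)).of_eq fun a => by
    tauto

theorem computablePred_eq {f g : α → ℕ} (hf : Computable f) (hg : Computable g) :
    ComputablePred fun a => f a = g a :=
  computablePred_comp (p := fun x : ℕ × ℕ => x.1 = x.2) Primrec.eq.computablePred (hf.pair hg)

theorem computablePred_lt {f g : α → ℕ} (hf : Computable f) (hg : Computable g) :
    ComputablePred fun a => f a < g a :=
  computablePred_comp (p := fun x : ℕ × ℕ => x.1 < x.2) Primrec.nat_lt.computablePred
    (hf.pair hg)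

theorem computablePred_forall_lt {p : α × ℕ → Prop} (hp : ComputablePred p) {f : α → ℕ}
    (hf : Computable f) : ComputablePred fun a => ∀ x < f a, p (a, x) := by
  obtain ⟨g, hg, rfl⟩ := ComputablePred.computable_iff.1 hp
  refine ComputablePred.computable_iff.2 ⟨fun a => Nat.rec (motive := fun _ => Bool) true
    (fun y b => g (a, y) && b) (f a), ?_, ?_⟩
  · exact Computable.nat_rec hf (.const true) (Primrec.and.to_comp.comp
      (hg.comp (Computable.fst.pair (Computable.fst.comp .snd)))
      (Computable.snd.comp .snd)).to₂
  · funext a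
    beta_reduce
    rw [eq_iff_iff]
    generalize f a = N
    induction N with
    | zero => simp
    | succ N ih =>
      simp [-Order.lt_add_one_iff, Nat.lt_succ_iff_lt_or_eq, or_imp, forall_and, ih, and_comm]

theorem computablePred_exists_lt {p : α × ℕ → Prop} (hp : ComputablePred p) {f : α → ℕ}
    (hf : Computable f) : ComputablePred fun a => ∃ x < f a, p (a, x) :=
  (computablePred_forall_lt hp.not hf).not.of_eq fun a => by simp

/-- The predicates of the form `∃ k, p (a, k)` with a computable `p`: the arithmetical counterpart
of `Σ⁰₁` formulae. -/
def SigmaOnePred (q : α → Prop) : Prop :=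
  ∃ p : α × ℕ → Prop, ComputablePred p ∧ ∀ a, q a ↔ ∃ k, p (a, k)

theorem SigmaOnePred.of_computablePred {q : α → Prop} (hq : ComputablePred q) : SigmaOnePred q :=
  ⟨_, computablePred_comp hq .fst, by simp⟩

theorem SigmaOnePred.exists {q : α × ℕ → Prop} (hq : SigmaOnePred q) :
    SigmaOnePred fun a => ∃ b, q (a, b) := by
  obtain ⟨p, hp, hpq⟩ := hq
  have hunpair : Computable fun x : α × ℕ => x.2.unpair := Computable.unpair.comp .snd
  refine ⟨fun x => p ((x.1, x.2.unpair.1), x.2.unpair.2), computablePred_comp hp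
    ((Computable.fst.pair (.comp .fst hunpair)).pair (.comp .snd hunpair)), fun a => ?_⟩
  simp only [hpq]
  exact ⟨fun ⟨b, k, h⟩ => ⟨Nat.pair b k, by simpa using h⟩, fun ⟨k, h⟩ => ⟨_, _, h⟩⟩

theorem SigmaOnePred.rePred {q : α → Prop} (hq : SigmaOnePred q) : REPred q := by
  obtain ⟨p, hp, hpq⟩ := hq
  obtain ⟨g, hg, rfl⟩ := ComputablePred.computable_iff.1 hp
  have hsearch : Partrec fun a => Nat.rfind fun k => (Part.some (g (a, k)) : Part Bool) :=
    Partrec.rfind hg.partrec.to₂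
  exact hsearch.dom_re.of_eq fun a =>
    Nat.rfind_dom.trans (by simp [hpq, @eq_comm Bool true])

theorem Term.computable_eval {n : ℕ} {v : α → Fin n → ℕ}
    (hv : ∀ i, Computable fun a => v a i) (t : Term n) : Computable fun a => t.eval (v a) := by
  induction t with
  | var i => exact hv i
  | zero => exact .const 0
  | one => exact .const 1
  | add s t hs ht => exact computable_nat_add hs ht
  | mul s t hs ht => exact computable_nat_mul hs ht

theorem computable_cons {n : ℕ} {v : α → Fin n → ℕ}
    (hv : ∀ i, Computable fun a => v a i) (i : Fin (n + 1)) :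
    Computable fun x : α × ℕ => (Fin.cons x.2 (v x.1) : Fin (n + 1) → ℕ) i := by
  cases i using Fin.cases with
  | zero => exact .snd
  | succ i => exact (hv i).comp .fst

end Computability

universe u

theorem IsBounded.computablePred (M : Set (Set ℕ)) {n m : ℕ} {φ : Formula n m} (h : IsBounded φ)
    {w : Fin m → Set ℕ} (hw : ∀ i, w i ∈ REC) :
    ∀ {α : Type u} [Primcodable α] {v : α → Fin n → ℕ}, (∀ i, Computable fun a => v a i) →
      ComputablePred fun a => φ.Holds M (v a) w := by
  induction h with (intro α _ v hv)
  | eq s t => exact computablePred_eq (s.computable_eval hv) (t.computable_eval hv)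
  | lt s t => exact computablePred_lt (s.computable_eval hv) (t.computable_eval hv)
  | mem t X => exact computablePred_comp (hw X.idx) (t.computable_eval hv)
  | neg _ ih => exact (ih hw hv).not
  | and _ _ ih₁ ih₂ => exact computablePred_and (ih₁ hw hv) (ih₂ hw hv)
  | or _ _ ih₁ ih₂ => exact computablePred_or (ih₁ hw hv) (ih₂ hw hv)
  | imp _ _ ih₁ ih₂ => exact computablePred_imp (ih₁ hw hv) (ih₂ hw hv)
  | iff _ _ ih₁ ih₂ => exact computablePred_iff (ih₁ hw hv) (ih₂ hw hv)
  | ball t _ ih =>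
    exact (computablePred_forall_lt (ih hw (computable_cons hv)) (t.computable_eval hv)).of_eq
      fun a => by simp [Formula.Holds, Term.eval]
  | bex t _ ih =>
    exact (computablePred_exists_lt (ih hw (computable_cons hv)) (t.computable_eval hv)).of_eq
      fun a => by simp [Formula.Holds, Term.eval]

theorem IsSigma01.sigmaOnePred (M : Set (Set ℕ)) {n m : ℕ} {φ : Formula n m} (h : IsSigma01 φ)
    {w : Fin m → Set ℕ} (hw : ∀ i, w i ∈ REC) :
    ∀ {α : Type u} [Primcodable α] {v : α → Fin n → ℕ}, (∀ i, Computable fun a => v a i) →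
      SigmaOnePred fun a => φ.Holds M (v a) w := by
  induction h with (intro α _ v hv)
  | of h => exact .of_computablePred (h.computablePred M hw hv)
  | ex _ ih => exact (ih hw (computable_cons hv)).exists

theorem IsPi01.sigmaOnePred_not (M : Set (Set ℕ)) {n m : ℕ} {φ : Formula n m} (h : IsPi01 φ)
    {w : Fin m → Set ℕ} (hw : ∀ i, w i ∈ REC) :
    ∀ {α : Type u} [Primcodable α] {v : α → Fin n → ℕ}, (∀ i, Computable fun a => v a i) →
      SigmaOnePred fun a => ¬ φ.Holds M (v a) w := by
  induction h with (intro α _ v hv)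
  | of h => exact .of_computablePred (h.computablePred M hw hv).not
  | all _ ih =>
    simp only [Formula.Holds, not_forall]
    exact (ih hw (computable_cons hv)).exists

theorem holds_deltaComprehension {n m : ℕ} {φ ψ : Formula (n + 1) m} (hφ : IsSigma01 φ)
    (hψ : IsPi01 ψ) (v : Fin n → ℕ) {w : Fin m → Set ℕ} (hw : ∀ i, w i ∈ REC) :
    (deltaComprehension φ ψ).Holds REC v w := by
  intro h
  have hiff : ∀ a : ℕ, φ.Holds REC (Fin.cons a v) w ↔ ψ.Holds REC (Fin.cons a v) w := h
  have hv : ∀ i, Computable fun a : ℕ => (Fin.cons a v : Fin (n + 1) → ℕ) i :=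
    Fin.cases .id fun i => .const (v i)
  have hre : REPred fun a : ℕ => φ.Holds REC (Fin.cons a v) w :=
    (hφ.sigmaOnePred REC hw hv).rePred
  have hco : REPred fun a : ℕ => ¬ φ.Holds REC (Fin.cons a v) w := by
    simpa only [hiff] using (hψ.sigmaOnePred_not REC hw hv).rePred
  have hA : {a : ℕ | φ.Holds REC (Fin.cons a v) w} ∈ REC :=
    ComputablePred.computable_iff_re_compl_re'.2 ⟨hre, hco⟩
  exact ⟨_, hA, fun a => by simp [Formula.Holds, Term.eval]⟩

theorem holds_inductionAxiom (M : Set (Set ℕ)) {n m : ℕ} (φ : Formula (n + 1) m) (v : Fin n → ℕ)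
    (w : Fin m → Set ℕ) : (inductionAxiom φ).Holds M v w := by
  rintro ⟨hzero, hsucc⟩ a
  have hstep : ∀ a : ℕ, φ.Holds M (Fin.cons a v) w → φ.Holds M (Fin.cons (a + 1) v) w := by
    intro a ha
    convert (Formula.holds_subst M _ _ _ _ _).1 (hsucc a ha) using 1
    funext i
    cases i using Fin.cases <;> simp [Term.eval]
  induction a with
  | zero => simpa [Term.eval] using hzero
  | succ a ih => exact hstep a ih

theorem models_basicAxioms (M : Set (Set ℕ)) : ∀ φ ∈ basicAxioms, Models M φ := by
  simp only [basicAxioms, Set.mem_insert_iff, Set.mem_singleton_iff, forall_eq_or_imp, forall_eq]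
  simp only [Models, allN, Formula.Holds, Term.eval, Term.eval_lift, Fin.cons_zero]
  refine ⟨?_, ?_, ?_, ?_, ?_, ?_, ?_, ?_⟩ <;> intros <;> first | omega | ring

theorem models_REC_RCA0 : ∀ φ ∈ RCA0, Models REC φ := by
  rintro φ ((h | ⟨n, m, φ, -, rfl⟩) | ⟨n, m, φ, ψ, hφ, hψ, rfl⟩)
  · exact models_basicAxioms REC φ h
  · exact .closure fun v w _ => holds_inductionAxiom REC φ v w
  · exact .closure fun v w hw => holds_deltaComprehension hφ hψ v hw

/-! ### Computable functions with rational values -/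

/-- The first component of a pair coded by `natPair`. -/
def natFst (z : ℕ) : ℕ := z - z.sqrt * z.sqrt

/-- The second component of a pair coded by `natPair`. -/
def natSnd (z : ℕ) : ℕ := z.sqrt - natFst z

theorem sqrt_natPair (a b : ℕ) : (natPair a b).sqrt = a + b :=
  Nat.sqrt_add_eq _ (by omega)

@[simp]
theorem natFst_natPair (a b : ℕ) : natFst (natPair a b) = a := by
  rw [natFst, sqrt_natPair, natPair, Nat.add_sub_cancel_left]

@[simp]
theorem natSnd_natPair (a b : ℕ) : natSnd (natPair a b) = b := by
  simp [natSnd, sqrt_natPair]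

@[simp]
theorem natPair_inj {a b c d : ℕ} : natPair a b = natPair c d ↔ a = c ∧ b = d :=
  ⟨fun h => ⟨by simpa using congrArg natFst h, by simpa using congrArg natSnd h⟩,
    fun h => h.1 ▸ h.2 ▸ rfl⟩

theorem natPair_le_natPair {a b c d : ℕ} (hac : a ≤ c) (hbd : b ≤ d) :
    natPair a b ≤ natPair c d := by
  unfold natPair
  gcongr

@[simp]
theorem natCast_toNat_sub_toNat_neg_num (q : ℚ) :
    (q.num.toNat : ℚ) - (-q.num).toNat = q.num :=
  mod_cast Int.toNat_sub_toNat_neg q.num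

theorem toNat_sub_toNat_neg_num_div_den (q : ℚ) :
    ((q.num.toNat : ℚ) - (-q.num).toNat) / q.den = q := by
  rw [natCast_toNat_sub_toNat_neg_num, Rat.num_div_den]

theorem ratCode_le_natPair {q : ℚ} {a b d : ℕ} (hd : 0 < d) (hq : q = ((a : ℚ) - b) / d) :
    ratCode q ≤ natPair (natPair a b) (natPair d 0) := by
  have hdvd : (q.den : ℤ) ∣ d := by
    have := Rat.den_dvd (a - b) d
    rwa [Rat.divInt_eq_div, Int.cast_sub, Int.cast_natCast, Int.cast_natCast, Int.cast_natCast,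
      ← hq] at this
  obtain ⟨g, rfl⟩ : q.den ∣ d := Int.natCast_dvd_natCast.1 hdvd
  have hg : 0 < g := Nat.pos_of_mul_pos_left hd
  have hnum : q.num * g = (a : ℤ) - b := by
    rw [eq_div_iff (mod_cast hd.ne'), Nat.cast_mul, ← mul_assoc, Rat.mul_den_eq_num] at hq
    exact_mod_cast hq
  refine natPair_le_natPair (natPair_le_natPair ?_ ?_)
    (natPair_le_natPair (Nat.le_mul_of_pos_right _ hg) le_rfl)
  · rw [Int.toNat_le]
    nlinarith
  · rw [Int.toNat_le]
    nlinarith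

/-- The rational number with a given code; numbers that do not code a fraction get a junk value. -/
def decodeRat (z : ℕ) : ℚ :=
  ((natFst (natFst z) : ℚ) - natSnd (natFst z)) / (max 1 (natFst (natSnd z)) : ℕ)

theorem decodeRat_natPair {a b d : ℕ} (hd : 0 < d) :
    decodeRat (natPair (natPair a b) (natPair d 0)) = ((a : ℚ) - b) / d := by
  simp [decodeRat, max_eq_right (Nat.succ_le_of_lt hd)]

@[simp]
theorem decodeRat_ratCode (q : ℚ) : decodeRat (ratCode q) = q := by
  rw [ratCode, decodeRat_natPair q.pos, toNat_sub_toNat_neg_num_div_den]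

theorem ratCode_injective : Function.Injective ratCode :=
  Function.LeftInverse.injective decodeRat_ratCode

section

variable {α β : Type*} [Primcodable α] [Primcodable β]

theorem computable_nat_sub {f g : α → ℕ} (hf : Computable f) (hg : Computable g) :
    Computable fun a => f a - g a :=
  Primrec.nat_sub.to_comp.comp hf hg

theorem computable_nat_div {f g : α → ℕ} (hf : Computable f) (hg : Computable g) :
    Computable fun a => f a / g a :=
  Primrec.nat_div.to_comp.comp hf hg

theorem computable_natPair {f g : α → ℕ} (hf : Computable f) (hg : Computable g) :
    Computable fun a => natPair (f a) (g a) :=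
  have hadd := computable_nat_add hf hg
  computable_nat_add (computable_nat_mul hadd hadd) hf

theorem computable_natFst : Computable natFst :=
  have hsqrt : Computable Nat.sqrt := Primrec.nat_sqrt.to_comp
  computable_nat_sub .id (computable_nat_mul hsqrt hsqrt)

theorem computable_natSnd : Computable natSnd :=
  computable_nat_sub Primrec.nat_sqrt.to_comp computable_natFst

theorem computable_two_pow : Computable fun n : ℕ => 2 ^ n :=
  (Computable.nat_rec .id (.const 1)
    (computable_nat_mul (.const 2) (Computable.snd.comp .snd)).to₂).of_eq fun n => by
      induction n with
      | zero => rfl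
      | succ n ih => rw [pow_succ', ← ih]; rfl

/-- A function with rational values is computable if its values are given by fractions, not
necessarily reduced, whose numerators and denominators are computable. The numerators are
represented as differences of natural numbers. -/
def RatComputable (f : α → ℚ) : Prop :=
  ∃ a b d : α → ℕ, Computable a ∧ Computable b ∧ Computable d ∧
    ∀ x, 0 < d x ∧ f x = ((a x : ℚ) - b x) / d x

namespace RatComputable

variable {f g : α → ℚ}

theorem of_eq (hf : RatComputable f) (h : ∀ x, f x = g x) : RatComputable g :=
  funext h ▸ hf

theorem comp {f : β → ℚ} (hf : RatComputable f) {h : α → β} (hh : Computable h) :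
    RatComputable fun x => f (h x) := by
  obtain ⟨a, b, d, ha, hb, hd, hf⟩ := hf
  exact ⟨_, _, _, ha.comp hh, hb.comp hh, hd.comp hh, fun x => hf _⟩

theorem const (q : ℚ) : RatComputable fun _ : α => q :=
  ⟨_, _, _, .const q.num.toNat, .const (-q.num).toNat, .const q.den,
    fun _ => ⟨q.pos, (toNat_sub_toNat_neg_num_div_den q).symm⟩⟩

theorem half_pow {h : α → ℕ} (hh : Computable h) : RatComputable fun x => (1 / 2 : ℚ) ^ h x :=
  ⟨_, _, _, .const 1, .const 0, computable_two_pow.comp hh, fun x => by simp⟩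

theorem add (hf : RatComputable f) (hg : RatComputable g) : RatComputable fun x => f x + g x := by
  obtain ⟨a, b, d, ha, hb, hd, hf⟩ := hf
  obtain ⟨a', b', d', ha', hb', hd', hg⟩ := hg
  refine ⟨_, _, _, computable_nat_add (computable_nat_mul ha hd') (computable_nat_mul ha' hd),
    computable_nat_add (computable_nat_mul hb hd') (computable_nat_mul hb' hd),
    computable_nat_mul hd hd', fun x => ?_⟩
  have hpos := (hf x).1
  have hpos' := (hg x).1
  refine ⟨Nat.mul_pos hpos hpos', ?_⟩
  beta_reduce
  rw [(hf x).2, (hg x).2]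
  push_cast
  field_simp
  ring

theorem mul (hf : RatComputable f) (hg : RatComputable g) : RatComputable fun x => f x * g x := by
  obtain ⟨a, b, d, ha, hb, hd, hf⟩ := hf
  obtain ⟨a', b', d', ha', hb', hd', hg⟩ := hg
  refine ⟨_, _, _, computable_nat_add (computable_nat_mul ha ha') (computable_nat_mul hb hb'),
    computable_nat_add (computable_nat_mul ha hb') (computable_nat_mul hb ha'),
    computable_nat_mul hd hd', fun x => ?_⟩
  have hpos := (hf x).1
  have hpos' := (hg x).1
  refine ⟨Nat.mul_pos hpos hpos', ?_⟩
  beta_reduce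
  rw [(hf x).2, (hg x).2]
  push_cast
  field_simp
  ring

theorem sub (hf : RatComputable f) (hg : RatComputable g) : RatComputable fun x => f x - g x :=
  (hf.add ((const (-1)).mul hg)).of_eq fun x => by ring

theorem lt (hf : RatComputable f) (hg : RatComputable g) :
    ComputablePred fun x => f x < g x := by
  obtain ⟨a, b, d, ha, hb, hd, hf⟩ := hf
  obtain ⟨a', b', d', ha', hb', hd', hg⟩ := hg
  refine (computablePred_lt
    (computable_nat_add (computable_nat_mul ha hd') (computable_nat_mul hb' hd))
    (computable_nat_add (computable_nat_mul ha' hd) (computable_nat_mul hb hd'))).of_eq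
    fun x => ?_
  have hpos : (0 : ℚ) < d x := mod_cast (hf x).1
  have hpos' : (0 : ℚ) < d' x := mod_cast (hg x).1
  rw [(hf x).2, (hg x).2, div_lt_div_iff₀ hpos hpos', ← Nat.cast_lt (α := ℚ)]
  push_cast
  constructor <;> intro <;> linarith

theorem eq (hf : RatComputable f) (hg : RatComputable g) : ComputablePred fun x => f x = g x :=
  (computablePred_and (hf.lt hg).not (hg.lt hf).not).of_eq fun x => by
    rw [not_lt, not_lt, and_comm, le_antisymm_iff]

theorem ite {p : α → Prop} [DecidablePred p] (hp : ComputablePred p) (hf : RatComputable f)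
    (hg : RatComputable g) : RatComputable fun x => if p x then f x else g x := by
  obtain ⟨a, b, d, ha, hb, hd, hf⟩ := hf
  obtain ⟨a', b', d', ha', hb', hd', hg⟩ := hg
  refine ⟨_, _, _, hp.decide.cond ha ha', hp.decide.cond hb hb', hp.decide.cond hd hd',
    fun x => ?_⟩
  by_cases hx : p x <;> simp [hx, hf x, hg x]

theorem max (hf : RatComputable f) (hg : RatComputable g) :
    RatComputable fun x => max (f x) (g x) :=
  (ite (hf.lt hg) hg hf).of_eq fun x => by
    split_ifs with h
    · exact (max_eq_right h.le).symm
    · exact (max_eq_left (not_lt.1 h)).symm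

theorem min (hf : RatComputable f) (hg : RatComputable g) :
    RatComputable fun x => min (f x) (g x) :=
  (ite (hf.lt hg) hf hg).of_eq fun x => by
    split_ifs with h
    · exact (min_eq_left h.le).symm
    · exact (min_eq_right (not_lt.1 h)).symm

theorem floor_inv (hf : RatComputable f) : Computable fun x => ⌊(f x)⁻¹⌋₊ := by
  obtain ⟨a, b, d, ha, hb, hd, hf⟩ := hf
  refine (computable_nat_div hd (computable_nat_sub ha hb)).of_eq fun x => ?_
  rw [(hf x).2, inv_div]
  rcases le_total (b x) (a x) with hba | hab
  · rw [← Nat.cast_sub hba, Nat.floor_div_eq_div]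
  · have hnonpos : (d x : ℚ) / (a x - b x) ≤ 0 :=
      div_nonpos_of_nonneg_of_nonpos (by positivity) (by simpa using hab)
    rw [Nat.sub_eq_zero_of_le hab, Nat.div_zero, Nat.floor_of_nonpos hnonpos]

end RatComputable

theorem ratComputable_decodeRat : RatComputable decodeRat :=
  ⟨_, _, _, computable_natFst.comp computable_natFst, computable_natSnd.comp computable_natFst,
    Primrec.nat_max.to_comp.comp (.const 1) (computable_natFst.comp computable_natSnd),
    fun z => ⟨by positivity, rfl⟩⟩

/-- The number `c` codes a fraction, not necessarily reduced, with positive denominator. -/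
def IsFractionCode (c : ℕ) : Prop :=
  0 < natFst (natSnd c) ∧
    c = natPair (natPair (natFst (natFst c)) (natSnd (natFst c))) (natPair (natFst (natSnd c)) 0)

theorem isFractionCode_natPair {a b d : ℕ} (hd : 0 < d) :
    IsFractionCode (natPair (natPair a b) (natPair d 0)) := by
  simp [IsFractionCode, hd]

theorem IsFractionCode.ratCode_decodeRat_le {c : ℕ} (hc : IsFractionCode c) :
    ratCode (decodeRat c) ≤ c := by
  obtain ⟨hd, hc⟩ := hc
  generalize natFst (natFst c) = a at hc
  generalize natSnd (natFst c) = b at hc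
  generalize natFst (natSnd c) = d at hc hd
  subst hc
  exact ratCode_le_natPair hd (decodeRat_natPair hd)

theorem computablePred_isFractionCode : ComputablePred IsFractionCode :=
  have hnum := Computable.comp computable_natFst computable_natFst
  have hneg := Computable.comp computable_natSnd computable_natFst
  have hden := Computable.comp computable_natFst computable_natSnd
  computablePred_and (computablePred_lt (.const 0) hden)
    (computablePred_eq .id (computable_natPair (computable_natPair hnum hneg)
      (computable_natPair hden (.const 0))))

theorem RatComputable.computable_ratCode {f : α → ℚ} (hf : RatComputable f) :
    Computable fun x => ratCode (f x) := by
  classical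
  -- `ratCode q` is the least fraction code with value `q`, so an unbounded search finds it.
  have hratCode : ∀ x, IsFractionCode (ratCode (f x)) ∧ decodeRat (ratCode (f x)) = f x :=
    fun x => ⟨isFractionCode_natPair (f x).pos, decodeRat_ratCode _⟩
  refine (Computable.find (P := fun x c => IsFractionCode c ∧ decodeRat c = f x)
    (computablePred_and (computablePred_comp computablePred_isFractionCode .snd)
      ((ratComputable_decodeRat.comp .snd).eq (hf.comp .fst)))
    fun x => ⟨_, hratCode x⟩).of_eq fun x => ?_
  refine le_antisymm (Nat.find_min' _ (hratCode x)) ((Nat.le_find_iff _ _).2 ?_)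
  rintro c hlt ⟨hc, hcf⟩
  exact hlt.not_ge (hcf ▸ hc.ratCode_decodeRat_le)

theorem ratComputable_iff {f : α → ℚ} :
    RatComputable f ↔ Computable fun x => ratCode (f x) :=
  ⟨RatComputable.computable_ratCode, fun h => (ratComputable_decodeRat.comp h).of_eq fun x => by
    simp⟩

theorem RatComputable.sum {f : α × ℕ → ℚ} (hf : RatComputable f) {N : α → ℕ}
    (hN : Computable N) : RatComputable fun x => ∑ k ∈ Finset.range (N x), f (x, k) := by
  have hstep : RatComputable fun y : α × ℕ × ℕ => decodeRat y.2.2 + f (y.1, y.2.1) :=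
    (ratComputable_decodeRat.comp (Computable.snd.comp .snd)).add
      (hf.comp (Computable.fst.pair (Computable.fst.comp .snd)))
  refine ratComputable_iff.2 ((Computable.nat_rec hN (.const (ratCode 0))
    hstep.computable_ratCode.to₂).of_eq fun x => ?_)
  induction N x with
  | zero => rfl
  | succ n ih => simp [ih, Finset.sum_range_succ]

end

/-! ### Codes of real numbers -/

/-- The approximations of a real number which second-order arithmetic reads off its code: the
error of the `k`-th term is at most `2 ^ (-k)`. -/
def Approximates (u : ℕ → ℚ) (U : ℝ) : Prop :=
  ∀ k, |(u k : ℝ) - U| ≤ (1 / 2) ^ k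

/-- Convergence of a sequence of rational numbers that codes a real number in second-order
arithmetic. -/
def RapidlyConverges (x : ℕ → ℚ) (X : ℝ) : Prop :=
  (∀ i j, i ≤ j → |x i - x j| ≤ (1 / 2) ^ i) ∧
    Filter.Tendsto (fun k => (x k : ℝ)) Filter.atTop (nhds X)

theorem tendsto_half_pow : Filter.Tendsto (fun k : ℕ => (1 / 2 : ℝ) ^ k) Filter.atTop (nhds 0) :=
  tendsto_pow_atTop_nhds_zero_of_lt_one (by norm_num) (by norm_num)

section

variable {u v x y : ℕ → ℚ} {U V X Y : ℝ}

theorem abs_cast_sub_cast_le {q r s : ℚ} (h : |q - r| ≤ s) : |(q : ℝ) - r| ≤ s :=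
  mod_cast h

theorem RapidlyConverges.approximates (hx : RapidlyConverges x X) : Approximates x X := fun k =>
  le_of_tendsto (tendsto_const_nhds.sub hx.2).abs (Filter.eventually_atTop.2
    ⟨k, fun j hkj => by simpa using abs_cast_sub_cast_le (hx.1 k j hkj)⟩)

theorem exists_rapidlyConverges (hx : ∀ i j, i ≤ j → |x i - x j| ≤ (1 / 2) ^ i) :
    ∃ X, RapidlyConverges x X := by
  suffices hcauchy : CauchySeq fun k => (x k : ℝ) from
    (cauchySeq_tendsto_of_complete hcauchy).imp fun X hX => ⟨hx, hX⟩
  refine cauchySeq_of_le_tendsto_0' (fun i => (1 / 2 : ℝ) ^ i) (fun i j hij => ?_)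
    tendsto_half_pow
  simpa [Real.dist_eq] using abs_cast_sub_cast_le (hx i j hij)

theorem rapidlyConverges_of_abs_sub_le (hy : ∀ k, |(y k : ℝ) - Y| ≤ (1 / 2) ^ (k + 1)) :
    RapidlyConverges y Y := by
  refine ⟨fun i j hij => ?_, ?_⟩
  · have hpow : (1 / 2 : ℝ) ^ (j + 1) ≤ (1 / 2) ^ (i + 1) :=
      pow_le_pow_of_le_one (by norm_num) (by norm_num) (by omega)
    have hreal : |(y i : ℝ) - y j| ≤ ((1 / 2 : ℚ) ^ i : ℚ) := calc
      |(y i : ℝ) - y j| ≤ |y i - Y| + |y j - Y| := abs_sub_comm (y j : ℝ) Y ▸ abs_sub_le _ _ _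
      _ ≤ (1 / 2) ^ (i + 1) + (1 / 2) ^ (i + 1) := add_le_add (hy i) ((hy j).trans hpow)
      _ = ((1 / 2 : ℚ) ^ i : ℚ) := by push_cast; ring
    exact_mod_cast hreal
  · rw [tendsto_iff_norm_sub_tendsto_zero]
    exact squeeze_zero (fun _ => norm_nonneg _) hy
      (tendsto_half_pow.comp (Filter.tendsto_add_atTop_nat 1))

namespace Approximates

theorem const (q : ℚ) : Approximates (fun _ => q) q := fun k => by
  simp

theorem neg (hu : Approximates u U) : Approximates (fun k => -u k) (-U) := fun k => by
  rw [Rat.cast_neg, ← neg_sub_neg, neg_neg, neg_neg, abs_sub_comm]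
  exact hu k

theorem add (hu : Approximates u U) (hv : Approximates v V) :
    Approximates (fun k => u (k + 1) + v (k + 1)) (U + V) := fun k => calc
  |((u (k + 1) + v (k + 1) : ℚ) : ℝ) - (U + V)|
      = |(u (k + 1) - U) + (v (k + 1) - V)| := by push_cast; ring_nf
  _ ≤ (1 / 2) ^ (k + 1) + (1 / 2) ^ (k + 1) :=
    (abs_add_le _ _).trans (add_le_add (hu _) (hv _))
  _ = (1 / 2) ^ k := by ring

theorem sub (hu : Approximates u U) (hv : Approximates v V) :
    Approximates (fun k => u (k + 1) - v (k + 1)) (U - V) := by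
  simpa only [sub_eq_add_neg] using hu.add hv.neg

theorem forall_le_add_iff (hu : Approximates u U) (hv : Approximates v V) :
    (∀ k, u k ≤ v k + (1 / (2 ^ k : ℕ) + 1 / (2 ^ k : ℕ))) ↔ U ≤ V := by
  have hcast : ∀ k, u k ≤ v k + (1 / (2 ^ k : ℕ) + 1 / (2 ^ k : ℕ)) ↔
      (u k : ℝ) ≤ v k + ((1 / 2) ^ k + (1 / 2) ^ k) := fun k => by
    rw [← Rat.cast_le (K := ℝ)]
    simp
  simp only [hcast]
  constructor
  · intro hle
    have hle_add : ∀ k, U ≤ V + 4 * (1 / 2) ^ k := fun k => by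
      linarith [hle k, (abs_le.1 (hu k)).1, (abs_le.1 (hv k)).2]
    exact ge_of_tendsto' (by simpa using (tendsto_half_pow.const_mul 4).const_add V) hle_add
  · intro hUV k
    linarith [(abs_le.1 (hu k)).2, (abs_le.1 (hv k)).1]

end Approximates

/-- The sequence of rational numbers `x`, as a set of pairs. -/
def seqSet (x : ℕ → ℚ) : Set ℕ := {z | ∃ k, z = natPair k (ratCode (x k))}

@[simp]
theorem natPair_mem_seqSet {k c : ℕ} : natPair k c ∈ seqSet x ↔ c = ratCode (x k) := by
  simp [seqSet]

theorem seqSet_injective : Function.Injective seqSet := fun _ _ hxy => funext fun _ =>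
  ratCode_injective (natPair_mem_seqSet.1 (hxy ▸ natPair_mem_seqSet.2 rfl))

theorem seqSet_mem_REC : seqSet x ∈ REC ↔ RatComputable x := by
  classical
  constructor
  · intro hx
    have hex : ∀ k, ∃ c, natPair k c ∈ seqSet x := fun k => ⟨_, natPair_mem_seqSet.2 rfl⟩
    refine ratComputable_iff.2 ((Computable.find (P := fun k c => natPair k c ∈ seqSet x)
      (computablePred_comp hx (computable_natPair .fst .snd)) hex).of_eq fun k => ?_)
    exact natPair_mem_seqSet.1 (Nat.find_spec (hex k))
  · intro hx
    refine (computablePred_eq .id (computable_natPair computable_natFst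
      (hx.comp computable_natFst).computable_ratCode)).of_eq fun z => ?_
    exact ⟨fun hz => ⟨_, hz⟩, by rintro ⟨k, rfl⟩; simp⟩

/-- The set `A` codes the real number `X` as a rapidly converging sequence of rational
numbers. -/
def IsRealCode (A : Set ℕ) (X : ℝ) : Prop :=
  ∃ x : ℕ → ℚ, A = seqSet x ∧ RapidlyConverges x X

namespace IsRealCode

variable {A : Set ℕ}

theorem isComputableReal (hX : IsRealCode A X) (hA : A ∈ REC) : IsComputableReal X := by
  obtain ⟨x, rfl, hx⟩ := hX
  exact ⟨x, (seqSet_mem_REC.1 hA).computable_ratCode, hx⟩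

theorem unique (hX : IsRealCode A X) (hY : IsRealCode A Y) : X = Y := by
  obtain ⟨x, rfl, hx⟩ := hX
  obtain ⟨y, hxy, hy⟩ := hY
  exact tendsto_nhds_unique hx.2 (seqSet_injective hxy ▸ hy.2)

end IsRealCode

end

/-! ### Contractions without fine partitions -/

theorem exists_mem_Icc_succ {α : Type*} [LinearOrder α] {x : ℕ → α} {y : α} {ℓ : ℕ} (hℓ : ℓ ≠ 0)
    (hy : y ∈ Set.Icc (x 0) (x ℓ)) : ∃ j < ℓ, y ∈ Set.Icc (x j) (x (j + 1)) := by
  induction ℓ with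
  | zero => exact absurd rfl hℓ
  | succ ℓ ih =>
    rcases eq_or_ne ℓ 0 with rfl | hℓ'
    · exact ⟨0, Nat.one_pos, hy⟩
    rcases le_total y (x ℓ) with hle | hge
    · obtain ⟨j, hj, hyj⟩ := ih hℓ' ⟨hy.1, hle⟩
      exact ⟨j, hj.trans ℓ.lt_succ_self, hyj⟩
    · exact ⟨ℓ, ℓ.lt_succ_self, hge, hy.2⟩

theorem tag_mem_Icc {α : Type*} [Preorder α] {x t : ℕ → α} {ℓ : ℕ}
    (hxt : ∀ j < ℓ, x j < t j ∧ t j < x (j + 1)) {j : ℕ} (hj : j < ℓ) :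
    t j ∈ Set.Icc (x 0) (x ℓ) := by
  have hmono : MonotoneOn x (Set.Iic ℓ) := monotoneOn_of_le_add_one Set.ordConnected_Iic
    fun i _ _ hi => ((hxt i hi).1.trans (hxt i hi).2).le
  exact ⟨(hmono ℓ.zero_le hj.le j.zero_le).trans (hxt j hj).1.le,
    (hxt j hj).2.le.trans (hmono (Nat.succ_le_of_lt hj) (Set.mem_Iic.2 le_rfl) hj)⟩

theorem not_fine_of_contracting_of_eq_zero {δ : ℝ → ℝ} {c : ℝ} (hc : c < 1)
    (hδ : ∀ x y, |δ x - δ y| ≤ c * |x - y|) {y : ℝ} (hy₀ : δ y = 0) {ℓ : ℕ} (hℓ : ℓ ≠ 0)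
    {x t : ℕ → ℝ} (hy : y ∈ Set.Icc (x 0) (x ℓ)) (hpos : ∀ j < ℓ, 0 < δ (t j)) :
    ¬ ∀ j < ℓ, t j - δ (t j) ≤ x j ∧ x (j + 1) ≤ t j + δ (t j) := by
  intro hfine
  obtain ⟨j, hj, hxy, hyx⟩ := exists_mem_Icc_succ hℓ hy
  have hclose : |t j - y| ≤ δ (t j) :=
    abs_le.2 ⟨by linarith [(hfine j hj).2], by linarith [(hfine j hj).1]⟩
  have hsmall : δ (t j) ≤ c * |t j - y| := by
    simpa [hy₀] using (le_abs_self _).trans (hδ (t j) y)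
  have hzero : |t j - y| ≤ 0 :=
    nonpos_of_mul_nonpos_right (a := 1 - c) (by linarith) (sub_pos.2 hc)
  have hcollapse : |t j - y| = 0 := hzero.antisymm (abs_nonneg _)
  rw [hcollapse, mul_zero] at hsmall
  exact hsmall.not_gt (hpos j hj)

/-! ### Sums of spikes -/

theorem spike_nonneg (p q : ℚ) (x : ℝ) : 0 ≤ spike p q x := le_max_left _ _

theorem spike_le_half (p q : ℚ) (x : ℝ) : spike p q x ≤ 1 / 2 :=
  max_le (by norm_num) (min_le_left _ _)

theorem spike_pos_iff {p q : ℚ} {x : ℝ} : 0 < spike p q x ↔ x ∈ Set.Ioo (p : ℝ) q := by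
  simp [spike]

theorem abs_spike_sub_le (p q : ℚ) (x y : ℝ) : |spike p q x - spike p q y| ≤ |x - y| := by
  refine (abs_max_sub_max_le_max _ _ _ _).trans (max_le (by simp) ?_)
  refine (abs_min_sub_min_le_max _ _ _ _).trans (max_le (by simp) ?_)
  refine (abs_min_sub_min_le_max _ _ _ _).trans (max_le (by simp) ?_)
  rw [sub_sub_sub_cancel_left, abs_sub_comm]

/-- The restriction of `spike` to the rational numbers. -/
def ratSpike (p q x : ℚ) : ℚ := max 0 (min (1 / 2) (min (x - p) (q - x)))

theorem cast_ratSpike (p q x : ℚ) : (ratSpike p q x : ℝ) = spike p q x := by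
  simp [ratSpike, spike]

theorem ratSpike_nonneg (p q x : ℚ) : 0 ≤ ratSpike p q x := le_max_left _ _

theorem ratSpike_le_half (p q x : ℚ) : ratSpike p q x ≤ 1 / 2 :=
  max_le (by norm_num) (min_le_left _ _)

/-- The partial sums of `spikeSum`, at rational numbers. -/
def spikePartialSum (ψ : ℕ → ℚ × ℚ) (m : ℕ) (x : ℚ) : ℚ :=
  ∑ k ∈ Finset.range m, (1 / 2) ^ (k + 2) * ratSpike (ψ k).1 (ψ k).2 x

theorem sum_half_pow (m : ℕ) :
    ∑ k ∈ Finset.range m, (1 / 2 : ℝ) ^ (k + 2) = 1 / 2 - (1 / 2) ^ (m + 1) := by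
  induction m with
  | zero => norm_num
  | succ m ih => rw [Finset.sum_range_succ, ih]; ring

section

variable (ψ : ℕ → ℚ × ℚ)

theorem cast_spikePartialSum (m : ℕ) (x : ℚ) : (spikePartialSum ψ m x : ℝ) =
    ∑ k ∈ Finset.range m, (1 / 2) ^ (k + 2) * spike (ψ k).1 (ψ k).2 x := by
  simp [spikePartialSum, cast_ratSpike]

theorem spikeTerm_nonneg (x : ℝ) (k : ℕ) :
    0 ≤ (1 / 2 : ℝ) ^ (k + 2) * spike (ψ k).1 (ψ k).2 x :=
  mul_nonneg (by positivity) (spike_nonneg _ _ _)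

theorem spikeTerm_le (x : ℝ) (k : ℕ) :
    (1 / 2 : ℝ) ^ (k + 2) * spike (ψ k).1 (ψ k).2 x ≤ (1 / 2) ^ 3 * (1 / 2) ^ k :=
  (mul_le_mul_of_nonneg_left (spike_le_half _ _ _) (by positivity)).trans_eq (by ring)

theorem summable_spike (x : ℝ) :
    Summable fun k => (1 / 2 : ℝ) ^ (k + 2) * spike (ψ k).1 (ψ k).2 x :=
  (summable_geometric_two.mul_left _).of_nonneg_of_le (spikeTerm_nonneg ψ x) (spikeTerm_le ψ x)

theorem abs_sum_spike_sub_le (m : ℕ) (x y : ℝ) :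
    |∑ k ∈ Finset.range m, (1 / 2) ^ (k + 2) * spike (ψ k).1 (ψ k).2 x -
      ∑ k ∈ Finset.range m, (1 / 2) ^ (k + 2) * spike (ψ k).1 (ψ k).2 y| ≤ 1 / 2 * |x - y| := by
  rw [← Finset.sum_sub_distrib]
  calc _ ≤ ∑ k ∈ Finset.range m, (1 / 2 : ℝ) ^ (k + 2) * |x - y| := by
        refine (Finset.abs_sum_le_sum_abs _ _).trans (Finset.sum_le_sum fun k _ => ?_)
        rw [← mul_sub, abs_mul, abs_of_nonneg (by positivity : (0 : ℝ) ≤ (1 / 2) ^ (k + 2))]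
        exact mul_le_mul_of_nonneg_left (abs_spike_sub_le _ _ _ _) (by positivity)
    _ ≤ 1 / 2 * |x - y| := by
        rw [← Finset.sum_mul, sum_half_pow]
        exact mul_le_mul_of_nonneg_right (by simp) (abs_nonneg _)

theorem abs_spikeSum_sub_le_half_mul (x y : ℝ) :
    |spikeSum ψ x - spikeSum ψ y| ≤ 1 / 2 * |x - y| :=
  le_of_tendsto (((summable_spike ψ x).hasSum.tendsto_sum_nat.sub
    (summable_spike ψ y).hasSum.tendsto_sum_nat).abs)
    (.of_forall fun m => abs_sum_spike_sub_le ψ m x y)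

theorem abs_spikeSum_sub_le (x y : ℝ) : |spikeSum ψ x - spikeSum ψ y| ≤ |x - y| :=
  (abs_spikeSum_sub_le_half_mul ψ x y).trans (by linarith [abs_nonneg (x - y)])

theorem spikeSum_eq_zero_of_mem_piClass {x : ℝ} (hx : x ∈ piClass ψ) : spikeSum ψ x = 0 := by
  refine (tsum_congr fun k => ?_).trans tsum_zero
  rw [(spike_nonneg _ _ _).antisymm' (not_lt.1 fun hpos =>
    hx.2 (Set.mem_iUnion.2 ⟨k, spike_pos_iff.1 hpos⟩)), mul_zero]

theorem spikeSum_pos_iff {x : ℝ} (hx : x ∈ Set.Icc (0 : ℝ) 1) :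
    0 < spikeSum ψ x ↔ x ∉ piClass ψ := by
  refine ⟨fun hpos hK => hpos.ne' (spikeSum_eq_zero_of_mem_piClass ψ hK), fun hK => ?_⟩
  obtain ⟨k, hk⟩ := Set.mem_iUnion.1 (not_not.1 fun hcover => hK ⟨hx, hcover⟩)
  exact (summable_spike ψ x).tsum_pos (spikeTerm_nonneg ψ x) k
    (mul_pos (by positivity) (spike_pos_iff.2 hk))

theorem spikePartialSum_le (m : ℕ) (x : ℚ) : (spikePartialSum ψ m x : ℝ) ≤ spikeSum ψ x := by
  rw [cast_spikePartialSum]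
  exact (summable_spike ψ x).sum_le_tsum _ fun k _ => spikeTerm_nonneg ψ x k

theorem spikeSum_le (m : ℕ) (x : ℚ) :
    spikeSum ψ x ≤ spikePartialSum ψ m x + (1 / 2 : ℝ) ^ (m + 2) := by
  have htail : HasSum (fun k : ℕ => (1 / 2 : ℝ) ^ (m + 3) * (1 / 2) ^ k) ((1 / 2) ^ (m + 2)) := by
    convert! hasSum_geometric_two.mul_left ((1 / 2 : ℝ) ^ (m + 3)) using 1
    ring
  rw [cast_spikePartialSum, spikeSum, ← (summable_spike ψ x).sum_add_tsum_nat_add m,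
    ← htail.tsum_eq]
  refine add_le_add_right (((summable_nat_add_iff m).2 (summable_spike ψ x)).tsum_le_tsum
    (fun k => ?_) htail.summable) _
  exact (spikeTerm_le ψ x (k + m)).trans_eq (by ring)

theorem spikePartialSum_mono {m m' : ℕ} (hm : m ≤ m') (x : ℚ) :
    spikePartialSum ψ m x ≤ spikePartialSum ψ m' x :=
  Finset.sum_le_sum_of_subset_of_nonneg (Finset.range_mono hm)
    fun _ _ _ => mul_nonneg (by positivity) (ratSpike_nonneg _ _ _)

theorem spikePartialSum_add_antitone {m m' : ℕ} (hm : m ≤ m') (x : ℚ) :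
    spikePartialSum ψ m' x + (1 / 2) ^ (m' + 2) ≤ spikePartialSum ψ m x + (1 / 2) ^ (m + 2) := by
  refine antitone_nat_of_succ_le (f := fun m => spikePartialSum ψ m x + (1 / 2) ^ (m + 2))
    (fun n => ?_) hm
  have hterm : (1 / 2 : ℚ) ^ (n + 2) * ratSpike (ψ n).1 (ψ n).2 x ≤ (1 / 2) ^ (n + 2) * (1 / 2) :=
    mul_le_mul_of_nonneg_left (ratSpike_le_half _ _ _) (by positivity)
  have hpow : (1 / 2 : ℚ) ^ (n + 1 + 2) = (1 / 2) ^ (n + 2) * (1 / 2) := by ring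
  rw [spikePartialSum, Finset.sum_range_succ, ← spikePartialSum, hpow]
  linarith

theorem abs_spikePartialSum_sub_le (m : ℕ) (x y : ℚ) :
    |spikePartialSum ψ m x - spikePartialSum ψ m y| ≤ |x - y| := by
  have hhalf := abs_sum_spike_sub_le ψ m x y
  rw [← cast_spikePartialSum, ← cast_spikePartialSum] at hhalf
  have hreal : (|spikePartialSum ψ m x - spikePartialSum ψ m y| : ℝ) ≤ |(x : ℝ) - y| :=
    hhalf.trans (by linarith [abs_nonneg ((x : ℝ) - y)])
  exact_mod_cast hreal

theorem not_hasComputableFinePartition_spikeSum (hK : (piClass ψ).Nonempty)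
    (hpos : ∀ x ∈ Set.Icc (0 : ℝ) 1, IsComputableReal x → 0 < spikeSum ψ x) :
    ¬ HasComputableFinePartition (spikeSum ψ) := by
  rintro ⟨ℓ, x, t, hx₀, hxℓ, -, ht, hxt, hfine⟩
  obtain ⟨y, hy⟩ := hK
  have hℓ : ℓ ≠ 0 := by
    rintro rfl
    exact zero_ne_one (hx₀.symm.trans hxℓ)
  refine not_fine_of_contracting_of_eq_zero one_half_lt_one (abs_spikeSum_sub_le_half_mul ψ)
    (spikeSum_eq_zero_of_mem_piClass ψ hy) hℓ (by rw [hx₀, hxℓ]; exact hy.1)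
    (fun j hj => hpos _ ?_ (ht j hj)) hfine
  simpa [hx₀, hxℓ] using tag_mem_Icc hxt hj

variable {ψ}

theorem ratComputable_spikePartialSum (hfst : RatComputable fun k => (ψ k).1)
    (hsnd : RatComputable fun k => (ψ k).2) {α : Type*} [Primcodable α] {m : α → ℕ} {x : α → ℚ}
    (hm : Computable m) (hx : RatComputable x) :
    RatComputable fun a => spikePartialSum ψ (m a) (x a) := by
  have hx' : RatComputable fun z : α × ℕ => x z.1 := hx.comp .fst
  have hspike : RatComputable fun z : α × ℕ => ratSpike (ψ z.2).1 (ψ z.2).2 (x z.1) :=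
    (RatComputable.const 0).max ((RatComputable.const _).min
      ((hx'.sub (hfst.comp .snd)).min ((hsnd.comp .snd).sub hx')))
  exact RatComputable.sum
    ((RatComputable.half_pow (computable_nat_add .snd (.const 2))).mul hspike) hm

theorem exists_isRealCode_spikeSum (hfst : RatComputable fun k => (ψ k).1)
    (hsnd : RatComputable fun k => (ψ k).2) {A : Set ℕ} (hA : A ∈ REC) {X : ℝ}
    (hX : IsRealCode A X) : ∃ B ∈ REC, IsRealCode B (spikeSum ψ X) := by
  obtain ⟨x, rfl, hx⟩ := hX
  let y : ℕ → ℚ := fun k => spikePartialSum ψ (k + 2) (x (k + 2))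
  have hshift : Computable fun k : ℕ => k + 2 := computable_nat_add .id (.const 2)
  have hy : RatComputable y :=
    ratComputable_spikePartialSum hfst hsnd hshift ((seqSet_mem_REC.1 hA).comp hshift)
  refine ⟨seqSet y, seqSet_mem_REC.2 hy, y, rfl, rapidlyConverges_of_abs_sub_le fun k => ?_⟩
  have hlip := abs_le.1 ((abs_spikeSum_sub_le_half_mul ψ (x (k + 2)) X).trans
    (mul_le_mul_of_nonneg_left (hx.approximates (k + 2)) (by norm_num)))
  have hlower := spikePartialSum_le ψ (k + 2) (x (k + 2))
  have hupper := spikeSum_le ψ (k + 2) (x (k + 2))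
  have hpow : (0 : ℝ) < (1 / 2) ^ k := by positivity
  simp only [pow_add] at hlip hupper ⊢
  rw [abs_le]
  constructor <;> linarith

end

/-! ### A singular cover of the computable reals -/

section Cover

open Nat.Partrec (Code)
open MeasureTheory

/-- The output of the `e`-th program at input `e + 4`, if it appears within `s` steps, where
`n` codes the pair of `e` and `s`. -/
def coverOutput (n : ℕ) : Option ℕ :=
  Code.evaln n.unpair.2 (Denumerable.ofNat Code n.unpair.1) (n.unpair.1 + 4)

/-- The rational number coded by `coverOutput n`, or `0` if there is no output. -/
def coverCenter (n : ℕ) : ℚ := decodeRat ((coverOutput n).getD 0)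

/-- Half the length of the interval contributed at stage `n`; it is `0`, and the interval is
empty, if there is no output. -/
def coverRadius (n : ℕ) : ℚ := if (coverOutput n).isSome then (1 / 2) ^ (n.unpair.1 + 3) else 0

/-- A computable sequence of open intervals that covers the computable reals. -/
def cover (n : ℕ) : ℚ × ℚ := (coverCenter n - coverRadius n, coverCenter n + coverRadius n)

theorem computable_coverOutput : Computable coverOutput :=
  Code.primrec_evaln.to_comp.comp (((Computable.snd.comp .unpair).pair
    ((Computable.ofNat Code).comp (Computable.fst.comp .unpair))).pair
      (computable_nat_add (Computable.fst.comp .unpair) (.const 4)))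

theorem ratComputable_coverCenter : RatComputable coverCenter :=
  ratComputable_decodeRat.comp (Computable.option_getD computable_coverOutput (.const 0))

theorem ratComputable_coverRadius : RatComputable coverRadius :=
  .ite (Computable.computablePred ((Primrec.option_isSome.to_comp.comp
    computable_coverOutput).of_eq fun n => by simp))
    (.half_pow (computable_nat_add (Computable.fst.comp .unpair) (.const 3))) (.const 0)

theorem ratComputable_cover_fst : RatComputable fun n => (cover n).1 :=
  ratComputable_coverCenter.sub ratComputable_coverRadius

theorem ratComputable_cover_snd : RatComputable fun n => (cover n).2 :=
  ratComputable_coverCenter.add ratComputable_coverRadius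

theorem cast_cover_of_mem_coverOutput {n y : ℕ} (hy : y ∈ coverOutput n) :
    Set.Ioo ((cover n).1 : ℝ) (cover n).2 =
      Metric.ball (decodeRat y : ℝ) ((1 / 2) ^ (n.unpair.1 + 3)) := by
  simp [Real.ball_eq_Ioo, cover, coverCenter, coverRadius, Option.mem_def.1 hy]

theorem exists_mem_cover {x : ℝ} (hx : IsComputableReal x) :
    ∃ n, x ∈ Set.Ioo ((cover n).1 : ℝ) (cover n).2 := by
  obtain ⟨q, hq, hqx⟩ := hx
  obtain ⟨c, hc⟩ := Code.exists_code.1 (Partrec.nat_iff.1 hq.partrec)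
  obtain ⟨e, rfl⟩ := (Denumerable.eqv Code).symm.surjective c
  change (Denumerable.ofNat Code e).eval = _ at hc
  have heval : ratCode (q (e + 4)) ∈ (Denumerable.ofNat Code e).eval (e + 4) := by
    rw [hc]
    exact Part.mem_some _
  obtain ⟨s, hs⟩ := Code.evaln_complete.1 heval
  have hout : ratCode (q (e + 4)) ∈ coverOutput (Nat.pair e s) := by
    simpa only [coverOutput, Nat.unpair_pair] using hs
  refine ⟨Nat.pair e s, ?_⟩
  rw [cast_cover_of_mem_coverOutput hout, decodeRat_ratCode, Nat.unpair_pair, Metric.mem_ball']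
  exact (RapidlyConverges.approximates hqx (e + 4)).trans_lt
    (pow_lt_pow_right_of_lt_one₀ (by norm_num) (by norm_num) (Nat.lt_succ_self _))

/-- The interval which the `e`-th program contributes to the cover; it is empty if that program
does not halt at input `e + 4`. -/
def programBall (e : ℕ) : Set ℝ :=
  ⋃ y ∈ (Denumerable.ofNat Code e).eval (e + 4), Metric.ball (decodeRat y : ℝ) ((1 / 2) ^ (e + 3))

theorem volume_programBall_le (e : ℕ) :
    volume (programBall e) ≤ ENNReal.ofReal (1 / 2 / 2 / 2 ^ e) := by
  by_cases hdom : ((Denumerable.ofNat Code e).eval (e + 4)).Dom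
  · have hball : programBall e ⊆ Metric.ball
        (decodeRat (((Denumerable.ofNat Code e).eval (e + 4)).get hdom) : ℝ)
        ((1 / 2) ^ (e + 3)) :=
      Set.iUnion₂_subset fun y hy => by rw [Part.get_eq_of_mem hy]
    refine (measure_mono hball).trans_eq ?_
    rw [Real.volume_ball]
    congr 1
    rw [one_div_pow]
    ring
  · have hempty : programBall e = ∅ := by
      simp only [programBall, Set.iUnion_eq_empty]
      exact fun y hy => absurd (Part.dom_iff_mem.2 ⟨y, hy⟩) hdom
    simp [hempty]

theorem Ioo_cover_subset_programBall (n : ℕ) :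
    Set.Ioo ((cover n).1 : ℝ) (cover n).2 ⊆ programBall n.unpair.1 := by
  rcases hout : coverOutput n with - | y
  · simp [cover, coverRadius, hout]
  · rw [cast_cover_of_mem_coverOutput hout]
    exact Set.subset_iUnion₂_of_subset y (Code.evaln_sound hout) subset_rfl

theorem diff_iUnion_nonempty_of_tsum_lt {α ι : Type*} [MeasurableSpace α] [Countable ι]
    {μ : Measure α} {s : Set α} {t : ι → Set α} (h : ∑' i, μ (t i) < μ s) :
    (s \ ⋃ i, t i).Nonempty :=
  Set.nonempty_of_not_subset fun hs => ((measure_mono hs).trans (measure_iUnion_le t)).not_gt h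

theorem piClass_cover_nonempty : (piClass cover).Nonempty := by
  have hlength : ∑' e, volume (programBall e) < volume (Set.Icc (0 : ℝ) 1) := calc
    ∑' e, volume (programBall e) ≤ ∑' e : ℕ, ENNReal.ofReal (1 / 2 / 2 / 2 ^ e) :=
      ENNReal.tsum_le_tsum volume_programBall_le
    _ = ENNReal.ofReal (1 / 2) := by
      rw [← ENNReal.ofReal_tsum_of_nonneg (fun _ => by positivity) (summable_geometric_two' _),
        tsum_geometric_two']
    _ < ENNReal.ofReal 1 := (ENNReal.ofReal_lt_ofReal_iff one_pos).2 one_half_lt_one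
    _ = volume (Set.Icc (0 : ℝ) 1) := by rw [Real.volume_Icc, sub_zero]
  refine (diff_iUnion_nonempty_of_tsum_lt hlength).mono (Set.sdiff_subset_sdiff_right ?_)
  exact Set.iUnion_subset fun n =>
    (Ioo_cover_subset_programBall n).trans (Set.subset_iUnion programBall _)

theorem not_isComputableReal_of_mem_piClass_cover {x : ℝ} (hx : x ∈ piClass cover) :
    ¬ IsComputableReal x := fun h => hx.2 (Set.mem_iUnion.2 (exists_mem_cover h))

theorem spikeSum_cover_pos {x : ℝ} (hx : x ∈ Set.Icc (0 : ℝ) 1) (h : IsComputableReal x) :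
    0 < spikeSum cover x :=
  (spikeSum_pos_iff cover hx).2 fun hK => not_isComputableReal_of_mem_piClass_cover hK h

theorem not_hasComputableFinePartition_spikeSum_cover :
    ¬ HasComputableFinePartition (spikeSum cover) :=
  not_hasComputableFinePartition_spikeSum cover piClass_cover_nonempty
    fun _ => spikeSum_cover_pos

end Cover

/-! ### A computable code of the sum of spikes -/

/-- The code of the pair of the intervals `(p, q)` and `(r, s)`. -/
def boxNat (p q r s : ℚ) : ℕ :=
  natPair (natPair (ratCode p) (ratCode q)) (natPair (ratCode r) (ratCode s))

/-- The midpoint of `(p, q) ∩ [0, 1]`. -/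
def unitMid (p q : ℚ) : ℚ := (max p 0 + min q 1) * (1 / 2)

/-- Half of the length of `(p, q) ∩ [0, 1]`. -/
def unitRadius (p q : ℚ) : ℚ := (min q 1 - max p 0) * (1 / 2)

/-- The number of spikes that are taken into account on `(p, q) ∩ [0, 1]`, large enough for the
remaining ones to contribute less than its length. -/
def unitStage (p q : ℚ) : ℕ := ⌊(unitRadius p q)⁻¹⌋₊

section Bounds

variable (ψ : ℕ → ℚ × ℚ) (p q : ℚ)

/-- A lower bound for `spikeSum ψ` on `(p, q) ∩ [0, 1]`. -/
def unitLower : ℚ := spikePartialSum ψ (unitStage p q) (unitMid p q) - unitRadius p q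

/-- An upper bound for `spikeSum ψ` on `(p, q) ∩ [0, 1]`. -/
def unitUpper : ℚ :=
  spikePartialSum ψ (unitStage p q) (unitMid p q) + (1 / 2) ^ (unitStage p q + 2) + unitRadius p q

end Bounds

/-- The interval `(p, q)` meets `[0, 1]`, and the bounds for `spikeSum ψ` on the intersection lie
in `(r, s)`. -/
structure InCode (ψ : ℕ → ℚ × ℚ) (p q r s : ℚ) : Prop where
  lt : p < q
  lt_one : p < 1
  pos : 0 < q
  lt_lower : r < unitLower ψ p q
  upper_lt : unitUpper ψ p q < s

/-- The code of `spikeSum ψ` on `[0, 1]`. -/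
def codeSet (ψ : ℕ → ℚ × ℚ) : Set ℕ := {z | ∃ p q r s, z = boxNat p q r s ∧ InCode ψ p q r s}

section CodeSet

variable {ψ : ℕ → ℚ × ℚ} {p q r s p' q' r' s' : ℚ}

@[simp]
theorem boxNat_mem_codeSet : boxNat p q r s ∈ codeSet ψ ↔ InCode ψ p q r s := by
  refine ⟨?_, fun h => ⟨p, q, r, s, rfl, h⟩⟩
  rintro ⟨p', q', r', s', hbox, h⟩
  simp only [boxNat, natPair_inj, ratCode_injective.eq_iff] at hbox
  obtain ⟨⟨rfl, rfl⟩, rfl, rfl⟩ := hbox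
  exact h

section Computability

variable {α : Type*} [Primcodable α] {f g u v : α → ℚ}

theorem ratComputable_unitMid (hf : RatComputable f) (hg : RatComputable g) :
    RatComputable fun a => unitMid (f a) (g a) :=
  ((hf.max (.const 0)).add (hg.min (.const 1))).mul (.const (1 / 2))

theorem ratComputable_unitRadius (hf : RatComputable f) (hg : RatComputable g) :
    RatComputable fun a => unitRadius (f a) (g a) :=
  ((hg.min (.const 1)).sub (hf.max (.const 0))).mul (.const (1 / 2))

theorem computable_unitStage (hf : RatComputable f) (hg : RatComputable g) :
    Computable fun a => unitStage (f a) (g a) :=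
  (ratComputable_unitRadius hf hg).floor_inv

theorem computablePred_inCode (hfst : RatComputable fun k => (ψ k).1)
    (hsnd : RatComputable fun k => (ψ k).2) (hf : RatComputable f) (hg : RatComputable g)
    (hu : RatComputable u) (hv : RatComputable v) :
    ComputablePred fun a => InCode ψ (f a) (g a) (u a) (v a) := by
  have hstage := computable_unitStage hf hg
  have hradius := ratComputable_unitRadius hf hg
  have hsum := ratComputable_spikePartialSum hfst hsnd hstage (ratComputable_unitMid hf hg)
  have hlower : RatComputable fun a => unitLower ψ (f a) (g a) := hsum.sub hradius
  have hupper : RatComputable fun a => unitUpper ψ (f a) (g a) :=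
    (hsum.add (.half_pow (computable_nat_add hstage (.const 2)))).add hradius
  refine (computablePred_and (hf.lt hg) <| computablePred_and (hf.lt (.const 1)) <|
    computablePred_and ((RatComputable.const 0).lt hg) <|
    computablePred_and (hu.lt hlower) (hupper.lt hv)).of_eq fun a => ?_
  exact ⟨fun ⟨h₁, h₂, h₃, h₄, h₅⟩ => ⟨h₁, h₂, h₃, h₄, h₅⟩,
    fun ⟨h₁, h₂, h₃, h₄, h₅⟩ => ⟨h₁, h₂, h₃, h₄, h₅⟩⟩

theorem codeSet_mem_REC (hfst : RatComputable fun k => (ψ k).1)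
    (hsnd : RatComputable fun k => (ψ k).2) : codeSet ψ ∈ REC := by
  have hp : RatComputable fun z => decodeRat (natFst (natFst z)) :=
    ratComputable_decodeRat.comp (computable_natFst.comp computable_natFst)
  have hq : RatComputable fun z => decodeRat (natSnd (natFst z)) :=
    ratComputable_decodeRat.comp (computable_natSnd.comp computable_natFst)
  have hr : RatComputable fun z => decodeRat (natFst (natSnd z)) :=
    ratComputable_decodeRat.comp (computable_natFst.comp computable_natSnd)
  have hs : RatComputable fun z => decodeRat (natSnd (natSnd z)) :=
    ratComputable_decodeRat.comp (computable_natSnd.comp computable_natSnd)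
  have hbox := computable_natPair (computable_natPair hp.computable_ratCode hq.computable_ratCode)
    (computable_natPair hr.computable_ratCode hs.computable_ratCode)
  refine (computablePred_and (computablePred_eq .id hbox)
    (computablePred_inCode hfst hsnd hp hq hr hs)).of_eq fun z => ?_
  constructor
  · exact fun h => ⟨_, _, _, _, h⟩
  · rintro ⟨p, q, r, s, rfl, h⟩
    simpa only [boxNat, natFst_natPair, natSnd_natPair, decodeRat_ratCode] using ⟨rfl, h⟩

end Computability

theorem unitRadius_pos (hpq : p < q) (hp : p < 1) (hq : 0 < q) : 0 < unitRadius p q :=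
  mul_pos (sub_pos.2 (by simp [*])) one_half_pos

theorem abs_sub_unitMid_le {x : ℝ} (hx : x ∈ Set.Icc (0 : ℝ) 1) (hpx : (p : ℝ) < x)
    (hxq : x < q) : |x - unitMid p q| ≤ unitRadius p q := by
  have hlo : max (p : ℝ) 0 ≤ x := max_le hpx.le hx.1
  have hhi : x ≤ min (q : ℝ) 1 := le_min hxq.le hx.2
  rw [abs_le, unitMid, unitRadius]
  push_cast
  constructor <;> linarith

theorem half_pow_unitStage_le (h : 0 < unitRadius p q) :
    (1 / 2 : ℚ) ^ (unitStage p q + 2) ≤ unitRadius p q := by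
  have hinv : (unitRadius p q)⁻¹ ≤ 2 ^ (unitStage p q + 2) := calc
    (unitRadius p q)⁻¹ ≤ (unitStage p q + 2 : ℕ) :=
      (Nat.lt_floor_add_one _).le.trans (by push_cast [unitStage]; linarith)
    _ ≤ 2 ^ (unitStage p q + 2) := mod_cast Nat.lt_two_pow_self.le
  rw [one_div, inv_pow]
  exact inv_le_of_inv_le₀ h hinv

namespace InCode

theorem unitRadius_pos (h : InCode ψ p q r s) : 0 < unitRadius p q :=
  SOA.unitRadius_pos h.lt h.lt_one h.pos

theorem spikeSum_mem_Ioo (h : InCode ψ p q r s) {x : ℝ} (hx : x ∈ Set.Icc (0 : ℝ) 1)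
    (hpx : (p : ℝ) < x) (hxq : x < q) : spikeSum ψ x ∈ Set.Ioo (r : ℝ) s := by
  have hr := (Rat.cast_lt (K := ℝ)).2 h.lt_lower
  have hs := (Rat.cast_lt (K := ℝ)).2 h.upper_lt
  rw [unitLower] at hr
  rw [unitUpper] at hs
  push_cast at hr hs
  have hclose := abs_le.1
    ((abs_spikeSum_sub_le ψ x (unitMid p q)).trans (abs_sub_unitMid_le hx hpx hxq))
  have hlower := spikePartialSum_le ψ (unitStage p q) (unitMid p q)
  have hupper := spikeSum_le ψ (unitStage p q) (unitMid p q)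
  constructor <;> linarith

theorem fst_lt_snd (h : InCode ψ p q r s) (h' : InCode ψ p q r' s') : r < s' := by
  have htail : (0 : ℚ) < (1 / 2) ^ (unitStage p q + 2) := by positivity
  calc r < unitLower ψ p q := h.lt_lower
    _ < unitUpper ψ p q := by
      rw [unitLower, unitUpper]
      linarith [h.unitRadius_pos]
    _ < s' := h'.upper_lt

theorem mono_right (h : InCode ψ p q r s) (hr : r' ≤ r) (hs : s ≤ s') : InCode ψ p q r' s' :=
  { h with
    lt_lower := hr.trans_lt h.lt_lower
    upper_lt := h.upper_lt.trans_le hs }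

theorem mono_left (h : InCode ψ p q r s) (hpq : p' < q') (hp' : p' < 1) (hq' : 0 < q')
    (hp : p < 0 ∨ p ≤ p') (hq : 1 < q ∨ q' ≤ q) : InCode ψ p' q' r s := by
  have hlo : max p 0 ≤ max p' 0 := by
    rcases hp with hp | hp
    · exact (max_eq_right hp.le).trans_le (le_max_right _ _)
    · exact max_le_max_right _ hp
  have hhi : min q' 1 ≤ min q 1 := by
    rcases hq with hq | hq
    · exact (min_le_right _ _).trans_eq (min_eq_right hq.le).symm
    · exact min_le_min_right _ hq
  have hradius : unitRadius p' q' ≤ unitRadius p q := by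
    unfold unitRadius
    linarith
  have hmid : |unitMid p' q' - unitMid p q| ≤ unitRadius p q - unitRadius p' q' := by
    unfold unitRadius unitMid
    rw [abs_le]
    constructor <;> linarith
  have hstage : unitStage p q ≤ unitStage p' q' :=
    Nat.floor_le_floor (inv_anti₀ (SOA.unitRadius_pos hpq hp' hq') hradius)
  have hclose := abs_le.1 ((abs_spikePartialSum_sub_le ψ (unitStage p q) _ _).trans hmid)
  have hlower : unitLower ψ p q ≤ unitLower ψ p' q' := by
    unfold unitLower
    linarith [spikePartialSum_mono ψ hstage (unitMid p' q')]
  have hupper : unitUpper ψ p' q' ≤ unitUpper ψ p q := by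
    unfold unitUpper
    linarith [spikePartialSum_add_antitone ψ hstage (unitMid p' q')]
  exact ⟨hpq, hp', hq', h.lt_lower.trans_le hlower, hupper.trans_lt h.upper_lt⟩

end InCode

theorem exists_inCode (ψ : ℕ → ℚ × ℚ) {x : ℝ} (hx : x ∈ Set.Icc (0 : ℝ) 1) {η : ℚ} (hη : 0 < η) :
    ∃ p q r s, InCode ψ p q r s ∧ (p : ℝ) < x ∧ x < q ∧ s - r ≤ η := by
  have hη' : (0 : ℝ) < η := mod_cast hη
  obtain ⟨p, hp, hpx⟩ := exists_rat_btwn (show x - η / 8 < x by linarith)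
  obtain ⟨q, hxq, hq⟩ := exists_rat_btwn (show x < x + η / 8 by linarith)
  have hpq : p < q := mod_cast hpx.trans hxq
  have hp₁ : p < 1 := mod_cast hpx.trans_le hx.2
  have hq₀ : 0 < q := mod_cast hx.1.trans_lt hxq
  have hlength : q - p < η / 4 := by
    have hcast : ((q - p : ℚ) : ℝ) < ((η / 4 : ℚ) : ℝ) := by
      push_cast
      linarith
    exact_mod_cast hcast
  have hradius : unitRadius p q ≤ η / 8 := by
    unfold unitRadius
    linarith [le_max_left p 0, min_le_left q 1]
  have htail := half_pow_unitStage_le (unitRadius_pos hpq hp₁ hq₀)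
  refine ⟨p, q, unitLower ψ p q - η / 8, unitUpper ψ p q + η / 8,
    ⟨hpq, hp₁, hq₀, by linarith, by linarith⟩, hpx, hxq, ?_⟩
  unfold unitLower unitUpper
  linarith

theorem codesFunction_codeSet (ψ : ℕ → ℚ × ℚ) : CodesFunction (codeSet ψ) (spikeSum ψ) := by
  refine ⟨fun p q r s hbox x hx hpx hxq =>
    (boxNat_mem_codeSet.1 hbox).spikeSum_mem_Ioo hx hpx hxq, fun x hx η hη => ?_⟩
  obtain ⟨p, q, r, s, h, hsize⟩ := exists_inCode ψ hx hη
  exact ⟨p, q, r, s, boxNat_mem_codeSet.2 h, hsize⟩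

end CodeSet

/-! ### The meaning of the formulae on numbers -/

section Numbers

variable {n m : ℕ} {M : Set (Set ℕ)} {v : Fin n → ℕ} {w : Fin m → Set ℕ}

@[simp]
theorem Formula.holds_allN {F : Term (n + 1) → Formula (n + 1) m} :
    (allN F).Holds M v w ↔ ∀ a : ℕ, (F (.var 0)).Holds M (Fin.cons a v) w := Iff.rfl

@[simp]
theorem Formula.holds_exN {F : Term (n + 1) → Formula (n + 1) m} :
    (exN F).Holds M v w ↔ ∃ a : ℕ, (F (.var 0)).Holds M (Fin.cons a v) w := Iff.rfl

@[simp]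
theorem Formula.holds_exS {F : SetVar (m + 1) → Formula n (m + 1)} :
    (exS F).Holds M v w ↔ ∃ A ∈ M, (F ⟨0⟩).Holds M v (Fin.cons A w) := Iff.rfl

@[simp]
theorem Term.eval_var_zero (a : ℕ) :
    (Term.var 0 : Term (n + 1)).eval (Fin.cons a v : Fin (n + 1) → ℕ) = a := rfl

@[simp]
theorem SetVar.cons_lift (X : SetVar m) (A : Set ℕ) :
    (Fin.cons A w : Fin (m + 1) → Set ℕ) X.lift.idx = w X.idx := rfl

@[simp]
theorem holds_le {s t : Term n} :
    (le s t : Formula n m).Holds M v w ↔ s.eval v ≤ t.eval v :=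
  Nat.le_iff_lt_or_eq.symm

@[simp]
theorem eval_pair {s t : Term n} : (pair s t).eval v = natPair (s.eval v) (t.eval v) := rfl

theorem natPair_lt_natPair {a b c d : ℕ} (hac : a < c) (hbd : b ≤ d) :
    natPair a b < natPair c d :=
  Nat.add_lt_add_of_le_of_lt (Nat.mul_le_mul (by lia) (by lia)) hac

@[simp]
theorem holds_isInt {a b : Term n} :
    (isInt a b : Formula n m).Holds M v w ↔ a.eval v = 0 ∨ b.eval v = 0 := by
  simp only [isInt, Formula.holds_allN, Formula.Holds, Term.eval, Term.eval_lift,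
    Fin.cons_zero, holds_le, eval_pair]
  refine ⟨fun hmin => ?_, fun hzero a' b' hdiff => natPair_le_natPair (by lia) (by lia)⟩
  by_contra! hne
  exact (hmin (a.eval v - 1) (b.eval v - 1) (by lia)).not_gt
    (natPair_lt_natPair (by lia) (by lia))

namespace RatTerm

/-- The rational number represented by the term `ρ`. -/
def eval (ρ : RatTerm n) (v : Fin n → ℕ) : ℚ :=
  ((ρ.pos.eval v : ℚ) - ρ.neg.eval v) / ρ.den.eval v

/-- The denominator of `ρ` is positive, so that the division in `RatTerm.eval` is a genuine one. -/
def DenPos (ρ : RatTerm n) (v : Fin n → ℕ) : Prop := 0 < ρ.den.eval v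

@[simp]
theorem eval_lift (ρ : RatTerm n) (a : ℕ) :
    ρ.lift.eval (Fin.cons a v : Fin (n + 1) → ℕ) = ρ.eval v := by
  simp [eval, lift]

@[simp]
theorem eval_code_lift (ρ : RatTerm n) (a : ℕ) :
    ρ.lift.code.eval (Fin.cons a v : Fin (n + 1) → ℕ) = ρ.code.eval v := by
  simp [code, lift, Term.eval]

theorem eval_code (ρ : RatTerm n) : ρ.code.eval v =
    natPair (natPair (ρ.pos.eval v) (ρ.neg.eval v)) (natPair (ρ.den.eval v) 0) := rfl

@[simp]
theorem eval_zero : (zero : RatTerm n).eval v = 0 := by simp [eval, zero, Term.eval]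

@[simp]
theorem eval_one : (one : RatTerm n).eval v = 1 := by simp [eval, one, Term.eval]

@[simp]
theorem eval_inv (d : Term n) : (inv d).eval v = 1 / (d.eval v : ℚ) := by
  simp [eval, inv, Term.eval]

@[simp]
theorem denPos_lift {ρ : RatTerm n} {a : ℕ} :
    ρ.lift.DenPos (Fin.cons a v : Fin (n + 1) → ℕ) ↔ ρ.DenPos v := by
  simp [DenPos, lift]

@[simp]
theorem denPos_zero : (zero : RatTerm n).DenPos v := one_pos

@[simp]
theorem denPos_one : (one : RatTerm n).DenPos v := one_pos

@[simp]
theorem denPos_inv {d : Term n} : (inv d).DenPos v ↔ 0 < d.eval v := Iff.rfl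

variable {ρ σ : RatTerm n}

@[simp]
theorem denPos_add : (ρ.add σ).DenPos v ↔ ρ.DenPos v ∧ σ.DenPos v :=
  CanonicallyOrderedAdd.mul_pos

@[simp]
theorem denPos_sub : (ρ.sub σ).DenPos v ↔ ρ.DenPos v ∧ σ.DenPos v :=
  CanonicallyOrderedAdd.mul_pos

theorem DenPos.cast_pos (hρ : ρ.DenPos v) : (0 : ℚ) < ρ.den.eval v := Nat.cast_pos.2 hρ

@[simp]
theorem eval_add (hρ : ρ.DenPos v) (hσ : σ.DenPos v) :
    (ρ.add σ).eval v = ρ.eval v + σ.eval v := by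
  rw [eval, eval, eval, div_add_div _ _ hρ.cast_pos.ne' hσ.cast_pos.ne']
  simp only [add, Term.eval]
  push_cast
  ring

@[simp]
theorem eval_sub (hρ : ρ.DenPos v) (hσ : σ.DenPos v) :
    (ρ.sub σ).eval v = ρ.eval v - σ.eval v := by
  rw [sub, eval_add hρ (by exact hσ), sub_eq_add_neg, eval, eval, eval, ← neg_div, neg_sub]

@[simp]
theorem holds_eq (hρ : ρ.DenPos v) (hσ : σ.DenPos v) :
    (ρ.eq σ : Formula n m).Holds M v w ↔ ρ.eval v = σ.eval v := by
  simp only [eq, eval, Term.eval, Formula.Holds]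
  rw [div_eq_div_iff hρ.cast_pos.ne' hσ.cast_pos.ne', ← Nat.cast_inj (R := ℚ)]
  push_cast
  constructor <;> intro <;> linarith

@[simp]
theorem holds_lt (hρ : ρ.DenPos v) (hσ : σ.DenPos v) :
    (ρ.lt σ : Formula n m).Holds M v w ↔ ρ.eval v < σ.eval v := by
  simp only [lt, eval, Term.eval, Formula.Holds]
  rw [div_lt_div_iff₀ hρ.cast_pos hσ.cast_pos, ← Nat.cast_lt (α := ℚ)]
  push_cast
  constructor <;> intro <;> linarith

@[simp]
theorem holds_le (hρ : ρ.DenPos v) (hσ : σ.DenPos v) :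
    (ρ.le σ : Formula n m).Holds M v w ↔ ρ.eval v ≤ σ.eval v := by
  simp only [le, eval, Term.eval, SOA.holds_le]
  rw [div_le_div_iff₀ hρ.cast_pos hσ.cast_pos, ← Nat.cast_le (α := ℚ)]
  push_cast
  constructor <;> intro <;> linarith

theorem holds_isRat_iff_minimal : (ρ.isRat : Formula n m).Holds M v w ↔
    (ρ.pos.eval v = 0 ∨ ρ.neg.eval v = 0) ∧ ρ.DenPos v ∧
      ∀ a b d : ℕ, (a = 0 ∨ b = 0) ∧ 0 < d ∧ ρ.eval v = ((a : ℚ) - b) / d →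
        ρ.code.eval v ≤ natPair (natPair a b) (natPair d 0) := by
  simp only [isRat, Formula.holds_allN, Formula.Holds, holds_isInt, Term.eval, SOA.holds_le,
    eval_code_lift]
  refine and_congr_right fun _ => and_congr_right fun hden => forall_congr' fun a =>
    forall_congr' fun b => forall_congr' fun d => imp_congr (and_congr_right fun _ =>
      and_congr_right fun hd => ?_) Iff.rfl
  rw [holds_eq (denPos_lift.2 (denPos_lift.2 (denPos_lift.2 hden))) (by exact hd)]
  simp only [eval_lift]
  rfl

theorem holds_isRat : (ρ.isRat : Formula n m).Holds M v w ↔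
    ∃ q : ℚ, ρ.pos.eval v = q.num.toNat ∧ ρ.neg.eval v = (-q.num).toNat ∧
      ρ.den.eval v = q.den := by
  rw [holds_isRat_iff_minimal]
  constructor
  · rintro ⟨-, hden, hmin⟩
    have hle : ρ.code.eval v ≤ ratCode (ρ.eval v) :=
      hmin _ _ _ ⟨by lia, (ρ.eval v).pos, (toNat_sub_toNat_neg_num_div_den _).symm⟩
    have hcode := hle.antisymm (ratCode_le_natPair hden rfl)
    rw [eval_code, ratCode, natPair_inj, natPair_inj, natPair_inj] at hcode
    exact ⟨ρ.eval v, hcode.1.1, hcode.1.2, hcode.2.1⟩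
  · rintro ⟨q, hpos, hneg, hden⟩
    have heval : ρ.eval v = q := by rw [eval, hpos, hneg, hden, toNat_sub_toNat_neg_num_div_den]
    refine ⟨by lia, q.pos.trans_eq hden.symm, fun a b d ⟨_, hd, hq⟩ => ?_⟩
    rw [eval_code, hpos, hneg, hden]
    exact ratCode_le_natPair hd (heval.symm.trans hq)

/-- The rational number that is given by the last three number variables. -/
abbrev vars : RatTerm (n + 3) := ⟨(Term.var 0).lift.lift, (Term.var 0).lift, .var 0⟩

end RatTerm

/-- The assignment `v`, extended so that the variables of `RatTerm.vars` represent `q`. -/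
abbrev consRat (q : ℚ) (v : Fin n → ℕ) : Fin (n + 3) → ℕ :=
  Fin.cons q.den (Fin.cons (-q.num).toNat (Fin.cons q.num.toNat v))

@[simp]
theorem RatTerm.eval_vars (q : ℚ) : (vars : RatTerm (n + 3)).eval (consRat q v) = q := by
  simpa [eval] using toNat_sub_toNat_neg_num_div_den q

@[simp]
theorem RatTerm.denPos_vars (q : ℚ) : (vars : RatTerm (n + 3)).DenPos (consRat q v) := q.pos

@[simp]
theorem RatTerm.eval_code_vars (q : ℚ) :
    (vars : RatTerm (n + 3)).code.eval (consRat q v) = ratCode q := by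
  simp [eval_code, ratCode]

theorem holds_allQ {F : RatTerm (n + 3) → Formula (n + 3) m} : (allQ F).Holds M v w ↔
    ∀ q : ℚ, (F .vars).Holds M (consRat q v) w := by
  simp only [allQ, Formula.holds_allN, Formula.Holds, RatTerm.holds_isRat, Term.eval_lift,
    Term.eval_var_zero]
  constructor
  · exact fun h q => h _ _ _ ⟨q, rfl, rfl, rfl⟩
  · rintro h a b d ⟨q, rfl, rfl, rfl⟩
    exact h q

theorem holds_exQ {F : RatTerm (n + 3) → Formula (n + 3) m} : (exQ F).Holds M v w ↔
    ∃ q : ℚ, (F .vars).Holds M (consRat q v) w := by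
  simp only [exQ, Formula.holds_exN, Formula.Holds, RatTerm.holds_isRat, Term.eval_lift,
    Term.eval_var_zero]
  constructor
  · rintro ⟨a, b, d, ⟨q, rfl, rfl, rfl⟩, h⟩
    exact ⟨q, h⟩
  · exact fun ⟨q, h⟩ => ⟨_, _, _, ⟨q, rfl, rfl, rfl⟩, h⟩

theorem holds_betaEq {c b i y : Term n} : (betaEq c b i y : Formula n m).Holds M v w ↔
    y.eval v = c.eval v % ((i.eval v + 1) * b.eval v + 1) := by
  simp only [betaEq, Formula.holds_exN, Formula.Holds, Term.eval, Term.eval_lift,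
    Fin.cons_zero]
  constructor
  · rintro ⟨hlt, z, hz⟩
    rw [hz, Nat.mul_add_mod', Nat.mod_eq_of_lt hlt]
  · intro hmod
    exact ⟨hmod ▸ Nat.mod_lt _ (Nat.succ_pos _), c.eval v / ((i.eval v + 1) * b.eval v + 1), by
      rw [hmod, Nat.div_add_mod']⟩

theorem exists_forall_le_mod_eq (f : ℕ → ℕ) (k : ℕ) :
    ∃ c b, ∀ i ≤ k, c % ((i + 1) * b + 1) = f i := by
  let l := (List.range (k + 1)).map f
  refine ⟨(Nat.unbeta l).unpair.1, (Nat.unbeta l).unpair.2, fun i hi => ?_⟩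
  have hlength : i < l.length := by simpa [l] using Nat.lt_succ_of_le hi
  have hbeta := Nat.beta_unbeta_coe l ⟨i, hlength⟩
  simpa [l, Nat.beta] using hbeta

@[simp]
theorem holds_isPow2 {k e : Term n} :
    (isPow2 k e : Formula n m).Holds M v w ↔ e.eval v = 2 ^ k.eval v := by
  simp only [isPow2, Formula.holds_exN, Formula.holds_allN, Formula.Holds, holds_betaEq,
    Term.eval, Term.eval_lift, Fin.cons_zero]
  constructor
  · rintro ⟨c, b, hzero, hk, hsucc⟩
    have hpow : ∀ i ≤ k.eval v, 2 ^ i = c % ((i + 1) * b + 1) := fun i hi => by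
      induction i with
      | zero => exact hzero
      | succ i ih =>
        rw [pow_succ, mul_two]
        exact hsucc i _ ⟨by lia, ih (by lia)⟩
    rw [hpow _ le_rfl, hk]
  · intro he
    obtain ⟨c, b, hpow⟩ := exists_forall_le_mod_eq (2 ^ ·) (k.eval v)
    refine ⟨c, b, (hpow 0 (Nat.zero_le _)).symm, he.trans (hpow _ le_rfl).symm, ?_⟩
    rintro i y ⟨hi, rfl⟩
    rw [hpow i hi.le, hpow (i + 1) hi, pow_succ, mul_two]

end Numbers

/-! ### The meaning of the formulae on real numbers -/

section Reals

variable {n m : ℕ} {M : Set (Set ℕ)} {v : Fin n → ℕ} {w : Fin m → Set ℕ}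

@[simp]
theorem eval_twoInv {e : Term n} (he : 0 < e.eval v) :
    (twoInv e).eval v = 1 / (e.eval v : ℚ) + 1 / (e.eval v : ℚ) := by
  simp [twoInv, he]

@[simp]
theorem denPos_twoInv {e : Term n} : (twoInv e).DenPos v ↔ 0 < e.eval v := by
  simp [twoInv]

theorem holds_isSeqRat {X : SetVar m} : (isSeqRat X : Formula n m).Holds M v w ↔
    ∃ x : ℕ → ℚ, w X.idx = seqSet x := by
  simp only [isSeqRat, Formula.Holds, Formula.holds_allN, Formula.holds_exN, holds_exQ,
    eval_pair, Term.eval_lift, Term.eval_var_zero, RatTerm.eval_code_vars]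
  constructor
  · rintro ⟨hpair, hfun⟩
    choose c hc hunique using hfun
    have hrat : ∀ k, ∃ q, c k = ratCode q := fun k => by
      obtain ⟨_, q, hq⟩ := hpair _ (hc k)
      exact ⟨q, (natPair_inj.1 hq).2⟩
    choose x hx using hrat
    refine ⟨x, Set.ext fun z => ⟨fun hz => ?_, ?_⟩⟩
    · obtain ⟨k, q, rfl⟩ := hpair z hz
      exact ⟨k, by rw [hunique k _ hz, hx]⟩
    · rintro ⟨k, rfl⟩
      exact hx k ▸ hc k
  · rintro ⟨x, hx⟩
    rw [hx]
    exact ⟨fun z ⟨k, hk⟩ => ⟨k, x k, hk⟩, fun k => ⟨_, natPair_mem_seqSet.2 rfl,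
      fun c hc => natPair_mem_seqSet.1 hc⟩⟩

section Values

variable {X Y T : SetVar m}

theorem holds_allVal {x : ℕ → ℚ} (hx : w X.idx = seqSet x) {k : Term n}
    {F : RatTerm (n + 3) → Formula (n + 3) m} : (allVal X k F).Holds M v w ↔
      (F .vars).Holds M (consRat (x (k.eval v)) v) w := by
  simp only [allVal, holds_allQ, Formula.Holds, eval_pair, Term.eval_lift,
    RatTerm.eval_code_vars, hx, natPair_mem_seqSet, ratCode_injective.eq_iff, forall_eq]

theorem holds_isReal_of_eq_seqSet {x : ℕ → ℚ} (hx : w X.idx = seqSet x) :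
    (isReal X : Formula n m).Holds M v w ↔ ∀ i j, i ≤ j → |x i - x j| ≤ (1 / 2) ^ i := by
  have hseq : (isSeqRat X : Formula n m).Holds M v w := holds_isSeqRat.2 ⟨x, hx⟩
  simp [isReal, Formula.Holds, hseq, holds_allVal hx, abs_sub_le_iff, add_comm]

theorem holds_isReal : (isReal X : Formula n m).Holds M v w ↔
    ∃ x, IsRealCode (w X.idx) x := by
  constructor
  · intro h
    obtain ⟨a, ha⟩ := holds_isSeqRat.1 h.1
    obtain ⟨x, hx⟩ := exists_rapidlyConverges ((holds_isReal_of_eq_seqSet ha).1 h)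
    exact ⟨x, a, ha, hx⟩
  · rintro ⟨x, a, ha, hx⟩
    exact (holds_isReal_of_eq_seqSet ha).2 hx.1

variable {x y t : ℝ}

theorem holds_realLe (hX : IsRealCode (w X.idx) x) (hY : IsRealCode (w Y.idx) y) :
    (realLe X Y : Formula n m).Holds M v w ↔ x ≤ y := by
  obtain ⟨a, ha, hax⟩ := hX
  obtain ⟨b, hb, hby⟩ := hY
  rw [← hax.approximates.forall_le_add_iff hby.approximates]
  simp [realLe, Formula.Holds, holds_allVal ha, holds_allVal hb]

theorem holds_realLeRat (hX : IsRealCode (w X.idx) x) {ρ : RatTerm n} (hρ : ρ.DenPos v) :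
    (realLeRat X ρ : Formula n m).Holds M v w ↔ x ≤ ρ.eval v := by
  obtain ⟨a, ha, hax⟩ := hX
  rw [← hax.approximates.forall_le_add_iff (.const _)]
  simp [realLeRat, Formula.Holds, holds_allVal ha, hρ]

theorem holds_ratLeReal (hX : IsRealCode (w X.idx) x) {ρ : RatTerm n} (hρ : ρ.DenPos v) :
    (ratLeReal ρ X : Formula n m).Holds M v w ↔ ρ.eval v ≤ x := by
  obtain ⟨a, ha, hax⟩ := hX
  rw [← (Approximates.const _).forall_le_add_iff hax.approximates]
  simp [ratLeReal, Formula.Holds, holds_allVal ha, hρ]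

theorem eq_of_holds_ratLeReal_of_holds_realLeRat (hX : IsRealCode (w X.idx) x) {ρ : RatTerm n}
    (hρ : ρ.DenPos v) (hge : (ratLeReal ρ X : Formula n m).Holds M v w)
    (hle : (realLeRat X ρ : Formula n m).Holds M v w) : x = ρ.eval v :=
  le_antisymm ((holds_realLeRat hX hρ).1 hle) ((holds_ratLeReal hX hρ).1 hge)

theorem holds_subLe (hT : IsRealCode (w T.idx) t) (hY : IsRealCode (w Y.idx) y)
    (hX : IsRealCode (w X.idx) x) : (subLe T Y X : Formula n m).Holds M v w ↔ t - y ≤ x := by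
  obtain ⟨a, ha, hax⟩ := hX
  obtain ⟨b, hb, hby⟩ := hY
  obtain ⟨c, hc, hct⟩ := hT
  rw [← (hct.approximates.sub hby.approximates).forall_le_add_iff hax.approximates]
  simp [subLe, Formula.Holds, holds_allVal ha, holds_allVal hb, holds_allVal hc, Term.eval]

theorem holds_leAdd (hX : IsRealCode (w X.idx) x) (hT : IsRealCode (w T.idx) t)
    (hY : IsRealCode (w Y.idx) y) : (leAdd X T Y : Formula n m).Holds M v w ↔ x ≤ t + y := by
  obtain ⟨a, ha, hax⟩ := hX
  obtain ⟨b, hb, hby⟩ := hY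
  obtain ⟨c, hc, hct⟩ := hT
  rw [← hax.approximates.forall_le_add_iff (hct.approximates.add hby.approximates)]
  simp [leAdd, Formula.Holds, holds_allVal ha, holds_allVal hb, holds_allVal hc, Term.eval]

theorem holds_inUnit : (inUnit X : Formula n m).Holds M v w ↔
    ∃ x ∈ Set.Icc (0 : ℝ) 1, IsRealCode (w X.idx) x := by
  have hbounds : ∀ {x}, IsRealCode (w X.idx) x →
      (((ratLeReal .zero X).and (realLeRat X .one) : Formula n m).Holds M v w ↔
        x ∈ Set.Icc (0 : ℝ) 1) := fun hx => by
    simp [Formula.Holds, holds_ratLeReal hx, holds_realLeRat hx]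
  constructor
  · rintro ⟨hreal, h⟩
    obtain ⟨x, hx⟩ := holds_isReal.1 hreal
    exact ⟨x, (hbounds hx).1 h, hx⟩
  · rintro ⟨x, hunit, hx⟩
    exact ⟨holds_isReal.2 ⟨x, hx⟩, (hbounds hx).2 hunit⟩

theorem holds_inInterval (hX : IsRealCode (w X.idx) x) {p q : RatTerm n} (hp : p.DenPos v)
    (hq : q.DenPos v) : (inInterval X p q : Formula n m).Holds M v w ↔
      x ∈ Set.Icc (0 : ℝ) 1 ∧ p.eval v < x ∧ x < q.eval v := by
  have hunit : (∃ y ∈ Set.Icc (0 : ℝ) 1, IsRealCode (w X.idx) y) ↔ x ∈ Set.Icc (0 : ℝ) 1 :=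
    ⟨fun ⟨y, hy, hYy⟩ => hX.unique hYy ▸ hy, fun hx => ⟨x, hx, hX⟩⟩
  simp only [inInterval, Formula.Holds, holds_inUnit, hunit, ratLtReal, realLtRat,
    holds_realLeRat hX hp, holds_ratLeReal hX hq, not_le]

end Values

/-! ### The meaning of the formulae on continuous functions -/

section Functions

variable {f X Y : SetVar m} {x y : ℝ}

@[simp]
theorem eval_boxCode {p q r s : RatTerm n} : (boxCode p q r s).eval v =
    natPair (natPair (p.code.eval v) (q.code.eval v)) (natPair (r.code.eval v) (s.code.eval v)) :=
  rfl

@[simp]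
theorem natPair_ratCode_eq_boxNat (p q r s : ℚ) :
    natPair (natPair (ratCode p) (ratCode q)) (natPair (ratCode r) (ratCode s)) =
      boxNat p q r s := rfl

theorem holds_inDomain (hX : IsRealCode (w X.idx) x) : (inDomain f X : Formula n m).Holds M v w ↔
    ∀ η : ℚ, 0 < η → ∃ p q r s : ℚ, boxNat p q r s ∈ w f.idx ∧
      (x ∈ Set.Icc (0 : ℝ) 1 ∧ p < x ∧ x < q) ∧ s - r ≤ η := by
  simp [inDomain, holds_allQ, exBox, holds_exQ, Formula.Holds, holds_inInterval hX]

theorem holds_isValue (hX : IsRealCode (w X.idx) x) (hY : IsRealCode (w Y.idx) y) :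
    (isValue f X Y : Formula n m).Holds M v w ↔ (inDomain f X : Formula n m).Holds M v w ∧
      ∀ p q r s : ℚ, boxNat p q r s ∈ w f.idx → (x ∈ Set.Icc (0 : ℝ) 1 ∧ p < x ∧ x < q) →
        r ≤ y ∧ y ≤ s := by
  have hreal : (isReal Y : Formula n m).Holds M v w := holds_isReal.2 ⟨y, hY⟩
  simp [isValue, allBox, holds_allQ, Formula.Holds, holds_inInterval hX, hreal,
    holds_ratLeReal hY, holds_realLeRat hY]

theorem holds_isContFun : (isContFun f : Formula n m).Holds M v w ↔
    (∀ z ∈ w f.idx, ∃ p q r s, z = boxNat p q r s ∧ (p < q ∧ p < 1 ∧ 0 < q) ∧ r < s) ∧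
    (∀ p q r s, boxNat p q r s ∈ w f.idx → ∀ r' s', boxNat p q r' s' ∈ w f.idx →
      r < s' ∧ r' < s) ∧
    (∀ p q r s, boxNat p q r s ∈ w f.idx → ∀ p' q', (p' < q' ∧ p' < 1 ∧ 0 < q') ∧
      (p < 0 ∨ p ≤ p') ∧ (1 < q ∨ q' ≤ q) → boxNat p' q' r s ∈ w f.idx) ∧
    (∀ p q r s, boxNat p q r s ∈ w f.idx → ∀ r' s', r' ≤ r ∧ s ≤ s' →
      boxNat p q r' s' ∈ w f.idx) := by
  simp [isContFun, allBox, holds_allQ, holds_exQ, Formula.Holds, isBasicUnit, unitSubset]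

/-- The real number in place `i` of the sequence of real numbers `P`, cf. `isEntry`. -/
def column (P : Set ℕ) (i : ℕ) : Set ℕ := {z | natPair i z ∈ P}

theorem holds_isEntry {P : SetVar m} {i : Term n} : (isEntry P i X : Formula n m).Holds M v w ↔
    (∃ x, IsRealCode (w X.idx) x) ∧ w X.idx = column (w P.idx) (i.eval v) := by
  simp [isEntry, Formula.Holds, holds_isReal, Set.ext_iff, column]

end Functions

end Reals

/-! ### The counterexample in the `ω`-model of the computable sets -/

section Gauge

variable {ψ : ℕ → ℚ × ℚ} {n m : ℕ} {M : Set (Set ℕ)} {v : Fin n → ℕ} {w : Fin m → Set ℕ}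
  {f P X Y : SetVar m} {ℓ : Term n} {x y : ℝ} {c : ℕ → ℝ}

theorem holds_isContFun_of_eq_codeSet (hf : w f.idx = codeSet ψ) :
    (isContFun f : Formula n m).Holds M v w := by
  rw [holds_isContFun, hf]
  simp only [boxNat_mem_codeSet]
  refine ⟨?_, fun p q r s h r' s' h' => ⟨h.fst_lt_snd h', h'.fst_lt_snd h⟩, ?_, ?_⟩
  · rintro z ⟨p, q, r, s, rfl, h⟩
    exact ⟨p, q, r, s, rfl, ⟨h.lt, h.lt_one, h.pos⟩, h.fst_lt_snd h⟩
  · rintro p q r s h p' q' ⟨⟨hlt, hlt_one, hpos⟩, hleft, hright⟩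
    exact h.mono_left hlt hlt_one hpos hleft hright
  · rintro p q r s h r' s' ⟨hr, hs⟩
    exact h.mono_right hr hs

theorem holds_inDomain_of_eq_codeSet (hf : w f.idx = codeSet ψ) (hx : x ∈ Set.Icc (0 : ℝ) 1)
    (hX : IsRealCode (w X.idx) x) : (inDomain f X : Formula n m).Holds M v w := by
  rw [holds_inDomain hX, hf]
  intro η hη
  obtain ⟨p, q, r, s, h, hpx, hxq, hsize⟩ := exists_inCode ψ hx hη
  exact ⟨p, q, r, s, boxNat_mem_codeSet.2 h, ⟨hx, hpx, hxq⟩, hsize⟩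

theorem holds_isValue_iff_of_eq_codeSet (hf : w f.idx = codeSet ψ) (hx : x ∈ Set.Icc (0 : ℝ) 1)
    (hX : IsRealCode (w X.idx) x) (hY : IsRealCode (w Y.idx) y) :
    (isValue f X Y : Formula n m).Holds M v w ↔ y = spikeSum ψ x := by
  simp only [holds_isValue hX hY, holds_inDomain_of_eq_codeSet hf hx hX, true_and, hf,
    boxNat_mem_codeSet]
  constructor
  · intro hvalue
    refine eq_of_forall_dist_le fun ε hε => ?_
    obtain ⟨η, hη, hηε⟩ := exists_rat_btwn hε
    obtain ⟨p, q, r, s, h, hpx, hxq, hsize⟩ := exists_inCode ψ hx (mod_cast hη : 0 < η)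
    have hlength : (s : ℝ) - r ≤ η := mod_cast hsize
    calc dist y (spikeSum ψ x) ≤ s - r := Real.dist_le_of_mem_Icc (hvalue p q r s h ⟨hx, hpx, hxq⟩)
          (Set.Ioo_subset_Icc_self (h.spikeSum_mem_Ioo hx hpx hxq))
      _ ≤ ε := hlength.trans hηε.le
  · rintro rfl p q r s h ⟨-, hpx, hxq⟩
    exact Set.Ioo_subset_Icc_self (h.spikeSum_mem_Ioo hx hpx hxq)

theorem holds_isTotalContGauge_of_eq_codeSet (hfst : RatComputable fun k => (ψ k).1)
    (hsnd : RatComputable fun k => (ψ k).2)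
    (hpos : ∀ x ∈ Set.Icc (0 : ℝ) 1, IsComputableReal x → 0 < spikeSum ψ x)
    (hf : w f.idx = codeSet ψ) : (isTotalContGauge f : Formula n m).Holds REC v w := by
  refine ⟨holds_isContFun_of_eq_codeSet hf, fun A _ hunit => ?_, fun A hA hunit => ?_⟩ <;>
    obtain ⟨x, hx, hAx⟩ := holds_inUnit.1 hunit
  · exact holds_inDomain_of_eq_codeSet hf hx hAx
  · obtain ⟨B, hB, hBx⟩ := exists_isRealCode_spikeSum hfst hsnd hA hAx
    have hvalue_pos := hpos x hx (hAx.isComputableReal hA)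
    refine ⟨B, hB, (holds_isValue_iff_of_eq_codeSet (by exact hf) hx (by exact hAx)
      (by exact hBx)).2 rfl, fun hnonpos => ?_⟩
    rw [holds_realLeRat (by exact hBx) (by simp), RatTerm.eval_zero, Rat.cast_zero] at hnonpos
    exact hnonpos.not_gt hvalue_pos

theorem exists_points_of_holds_isPartition
    (hpartition : (isPartition P ℓ : Formula n m).Holds M v w) :
    ∃ c : ℕ → ℝ, (∀ i ≤ ℓ.eval v + ℓ.eval v,
        column (w P.idx) i ∈ M ∧ IsRealCode (column (w P.idx) i) (c i)) ∧
      c 0 = 0 ∧ c (ℓ.eval v + ℓ.eval v) = 1 ∧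
      ∀ j < ℓ.eval v, c (j + j) < c (j + j + 1) ∧ c (j + j + 1) < c (j + j + 1 + 1) := by
  obtain ⟨-, hentry, hzero, hone, hlt⟩ := hpartition
  simp only [Formula.holds_allN, Formula.holds_exS, Formula.Holds, holds_isEntry, holds_le,
    Term.eval, Term.eval_lift, Fin.cons_zero, SetVar.cons_lift]
    at hentry hzero hone hlt
  have hcodes : ∀ i ≤ ℓ.eval v + ℓ.eval v, ∃ x,
      column (w P.idx) i ∈ M ∧ IsRealCode (column (w P.idx) i) x := fun i hi => by
    obtain ⟨A, hA, ⟨x, hx⟩, rfl⟩ := hentry i hi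
    exact ⟨x, hA, hx⟩
  choose! c hc using hcodes
  refine ⟨c, hc, ?_, ?_, fun j hj => ?_⟩
  · obtain ⟨A, -, ⟨-, rfl⟩, hge, hle⟩ := hzero
    simpa using eq_of_holds_ratLeReal_of_holds_realLeRat (by exact (hc 0 (Nat.zero_le _)).2)
      RatTerm.denPos_zero hge hle
  · obtain ⟨A, -, ⟨-, rfl⟩, hge, hle⟩ := hone
    simpa using eq_of_holds_ratLeReal_of_holds_realLeRat (by exact (hc _ le_rfl).2)
      RatTerm.denPos_one hge hle
  · obtain ⟨A, -, B, -, C, -, ⟨-, rfl⟩, ⟨-, rfl⟩, ⟨-, rfl⟩, hleft, hright⟩ := hlt j hj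
    have hA := (hc (j + j) (by lia)).2
    have hB := (hc (j + j + 1) (by lia)).2
    have hC := (hc (j + j + 1 + 1) (by lia)).2
    rw [realLt, Formula.Holds, holds_realLe (by exact hB) (by exact hA), not_le] at hleft
    rw [realLt, Formula.Holds, holds_realLe (by exact hC) (by exact hB), not_le] at hright
    exact ⟨hleft, hright⟩

theorem fine_of_holds_isFine (hf : w f.idx = codeSet ψ)
    (hc : ∀ i ≤ ℓ.eval v + ℓ.eval v, IsRealCode (column (w P.idx) i) (c i))
    (htag : ∀ j < ℓ.eval v, c (j + j + 1) ∈ Set.Icc (0 : ℝ) 1)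
    (hfine : (isFine f P ℓ : Formula n m).Holds M v w) {j : ℕ} (hj : j < ℓ.eval v) :
    c (j + j + 1) - spikeSum ψ (c (j + j + 1)) ≤ c (j + j) ∧
      c (j + j + 1 + 1) ≤ c (j + j + 1) + spikeSum ψ (c (j + j + 1)) := by
  obtain ⟨A, -, B, -, C, -, Y, -, hA, hB, hC, hY, hleft, hright⟩ :=
    hfine j (by simpa [Formula.Holds] using hj)
  have hcode : ∀ {i A}, i ≤ ℓ.eval v + ℓ.eval v → A = column (w P.idx) i → IsRealCode A (c i) :=
    fun hi hA => hA ▸ hc _ hi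
  have hx := hcode (i := j + j) (by lia) (holds_isEntry.1 hA).2
  have ht := hcode (i := j + j + 1) (by lia) (holds_isEntry.1 hB).2
  have hx' := hcode (i := j + j + 1 + 1) (by lia) (holds_isEntry.1 hC).2
  obtain ⟨y, hy⟩ := holds_isReal.1 hY.2.1
  obtain rfl :=
    (holds_isValue_iff_of_eq_codeSet (by exact hf) (htag j hj) (by exact ht) hy).1 hY
  exact ⟨(holds_subLe (by exact ht) (by exact hy) (by exact hx)).1 hleft,
    (holds_leAdd (by exact hx') (by exact ht) (by exact hy)).1 hright⟩

theorem hasComputableFinePartition_of_holds (hf : w f.idx = codeSet ψ)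
    (h : (hasFinePartition f : Formula n m).Holds REC v w) :
    HasComputableFinePartition (spikeSum ψ) := by
  obtain ⟨P, -, ℓ, hpartition, hfine⟩ := h
  obtain ⟨c, hc, hzero, hone, hlt⟩ := exists_points_of_holds_isPartition hpartition
  have hcomputable : ∀ i ≤ ℓ + ℓ, IsComputableReal (c i) := fun i hi =>
    (hc i hi).2.isComputableReal (hc i hi).1
  have hsucc : ∀ j, c (j + 1 + (j + 1)) = c (j + j + 1 + 1) := fun j => congrArg c (by lia)
  have hstep : ∀ j < ℓ, c (j + j) < c (j + j + 1) ∧ c (j + j + 1) < c (j + 1 + (j + 1)) :=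
    fun j hj => hsucc j ▸ hlt j hj
  have htag : ∀ j < ℓ, c (j + j + 1) ∈ Set.Icc (0 : ℝ) 1 := fun j hj => by
    rw [← hzero, ← hone]
    exact tag_mem_Icc (x := fun j => c (j + j)) (t := fun j => c (j + j + 1)) hstep hj
  refine ⟨ℓ, fun j => c (j + j), fun j => c (j + j + 1), hzero, hone,
    fun j hj => hcomputable _ (by lia), fun j hj => hcomputable _ (by lia), hstep, fun j hj => ?_⟩
  have hj_fine := fine_of_holds_isFine (by exact hf) (fun i hi => (hc i hi).2) htag hfine hj
  exact ⟨hj_fine.1, (hsucc j).trans_le hj_fine.2⟩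

end Gauge

theorem codeSet_cover_mem_REC : codeSet cover ∈ REC :=
  codeSet_mem_REC ratComputable_cover_fst ratComputable_cover_snd

theorem holds_isTotalContGauge_codeSet_cover :
    (isTotalContGauge ⟨0⟩ : Formula 0 1).Holds REC ![] ![codeSet cover] :=
  holds_isTotalContGauge_of_eq_codeSet ratComputable_cover_fst ratComputable_cover_snd
    (fun _ => spikeSum_cover_pos) rfl

theorem not_holds_hasFinePartition_codeSet_cover :
    ¬ (hasFinePartition ⟨0⟩ : Formula 0 1).Holds REC ![] ![codeSet cover] := fun h =>
  not_hasComputableFinePartition_spikeSum_cover (hasComputableFinePartition_of_holds rfl h)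

theorem not_models_REC_CLc : ¬ Models REC CLc := fun h =>
  not_holds_hasFinePartition_codeSet_cover
    (h _ codeSet_cover_mem_REC holds_isTotalContGauge_codeSet_cover)

theorem not_proves_RCA0_CLc : ¬ Proves RCA0 CLc := fun h =>
  not_models_REC_CLc (h.models models_REC_RCA0)

end SOA

theorem mainTheorem4 :
    ¬ SOA.Proves SOA.RCA0 SOA.CLc ∧
    (∀ φ ∈ SOA.RCA0, SOA.Models SOA.REC φ) ∧
    ¬ SOA.Models SOA.REC SOA.CLc ∧
    ∃ ψ : ℕ → ℚ × ℚ,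
      Computable (fun k => SOA.natPair (SOA.ratCode (ψ k).1) (SOA.ratCode (ψ k).2)) ∧
      (SOA.piClass ψ).Nonempty ∧
      (∀ x ∈ SOA.piClass ψ, ¬ SOA.IsComputableReal x) ∧
      (∀ x y : ℝ, |SOA.spikeSum ψ x - SOA.spikeSum ψ y| ≤ |x - y|) ∧
      (∀ x ∈ Set.Icc (0 : ℝ) 1, 0 < SOA.spikeSum ψ x ↔ x ∉ SOA.piClass ψ) ∧
      (∀ x ∈ Set.Icc (0 : ℝ) 1, SOA.IsComputableReal x → 0 < SOA.spikeSum ψ x) ∧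
      ¬ SOA.HasComputableFinePartition (SOA.spikeSum ψ) ∧
      ∃ f ∈ SOA.REC,
        SOA.CodesFunction f (SOA.spikeSum ψ) ∧
        (SOA.isTotalContGauge ⟨0⟩ : SOA.Formula 0 1).Holds SOA.REC ![] ![f] ∧
        ¬ (SOA.hasFinePartition ⟨0⟩ : SOA.Formula 0 1).Holds SOA.REC ![] ![f] :=
  ⟨SOA.not_proves_RCA0_CLc, SOA.models_REC_RCA0, SOA.not_models_REC_CLc, SOA.cover,
    SOA.computable_natPair SOA.ratComputable_cover_fst.computable_ratCode
      SOA.ratComputable_cover_snd.computable_ratCode,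
    SOA.piClass_cover_nonempty, fun _ => SOA.not_isComputableReal_of_mem_piClass_cover,
    SOA.abs_spikeSum_sub_le _, fun _ => SOA.spikeSum_pos_iff _,
    fun _ => SOA.spikeSum_cover_pos, SOA.not_hasComputableFinePartition_spikeSum_cover,
    SOA.codeSet SOA.cover, SOA.codeSet_cover_mem_REC, SOA.codesFunction_codeSet _,
    SOA.holds_isTotalContGauge_codeSet_cover, SOA.not_holds_hasFinePartition_codeSet_cover⟩
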